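/- Let $R=\bigoplus_{n\ge 0}R_n$ be a standard graded algebra over an infinite field $k$ (that is, $R\neq 0$, $R_0=k$ and $R$ is generated as a $k$-algebra by the finite-dimensional space $R_1$), and let $\mathfrak m=\bigoplus_{n\geq 1}R_n$. Let $I\subset R$ be an ideal of height $g$ generated by forms of one degree $d$. Write $\mathcal R(I)=\bigoplus_{n\ge0}I^nt^n\subset R[t]$ for the Rees algebra of $I$, ${\rm gr}_I(R)=\mathcal R(I)/I\mathcal R(I)$ for the associated graded ring, $\mathcal F(I)=\mathcal R(I)/\mathfrak m\mathcal R(I)$ for the special fiber, and $\ell(I)=\dim\mathcal F(I)$ for the analytic spread. Assume that $I$ has analytic deviation one, i.e. $\ell(I)=g+1$. For an ideal $\mathfrak a\subset R$ put $[\mathfrak a]_n=\mathfrak a\cap R_n$. Let $f_1,\dots,f_{g+1}\in [I]_d$ be such that (a) the images of $f_1,\dots,f_g$ in $I/I^2=[{\rm gr}_I(R)]_1$ form a regular sequence in ${\rm gr}_I(R)$; (b) $J=(f_1,\dots,f_{g+1})$ is a reduction of $I$, i.e. $J\subseteq I$ and $JI^n=I^{n+1}$ for some $n\ge 0$. Then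 the following are equivalent: (i) the sequence $f_1,\dots,f_{g+1}$ is analytically tight, i.e. for every $n\geq 1$ $$[((f_1,\dots,f_g):f_{g+1})\cap I^n]_{nd}=[(f_1,\dots,f_g)\cap I^n]_{nd};$$ (ii) the special fiber $\mathcal F(I)$ is a Cohen–Macaulay ring. -/

import Mathlib

open Polynomial

namespace FiberCone

section CohenMacaulay

/-- The depth of a local ring: the supremum of the lengths of regular sequences
contained in its maximal ideal. -/
noncomputable def depth (A : Type*) [CommRing A] [IsLocalRing A] : ℕ∞ :=
  ⨆ rs : {rs : List A // (∀ r ∈ rs, r ∈ IsLocalRing.maximalIdeal A) ∧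
    RingTheory.Sequence.IsRegular A rs}, (rs.1.length : ℕ∞)

/-- A local ring is Cohen–Macaulay if it is Noetherian and its depth equals its Krull dimension. -/
def IsCohenMacaulayLocalRing (A : Type*) [CommRing A] [IsLocalRing A] : Prop :=
  IsNoetherianRing A ∧ ((depth A : ℕ∞) : WithBot ℕ∞) = ringKrullDim A

/-- A ring is Cohen–Macaulay if it is Noetherian and all its localizations at maximal ideals
are Cohen–Macaulay local rings. -/
def IsCohenMacaulayRing (A : Type*) [CommRing A] : Prop :=
  IsNoetherianRing A ∧
    ∀ (p : Ideal A) [p.IsMaximal], IsCohenMacaulayLocalRing (Localization.AtPrime p)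

end CohenMacaulay

section Blowup

variable {R : Type*} [CommRing R]

/-- The associated graded ring `gr_I(R) = R[It] / I R[It]`. -/
abbrev AssociatedGradedRing (I : Ideal R) : Type _ :=
  reesAlgebra I ⧸ I.map (algebraMap R (reesAlgebra I))

/-- The image `fᵒ` of an element `f ∈ I` in the degree one piece `I / I²` of `gr_I(R)`,
that is, the class of `f t`. -/
noncomputable def grImage (I : Ideal R) (f : I) : AssociatedGradedRing I :=
  Ideal.Quotient.mk _
    (⟨monomial 1 (f : R), reesAlgebra.monomial_mem.2 (by simp)⟩ : reesAlgebra I)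

/-- `J` is a reduction of `I`: `J ⊆ I` and `J Iⁿ = Iⁿ⁺¹` for some `n`. -/
def IsReduction (J I : Ideal R) : Prop :=
  J ≤ I ∧ ∃ n : ℕ, J * I ^ n = I ^ (n + 1)

end Blowup

section Graded

variable {k R : Type*} [Field k] [CommRing R] [Algebra k R]

/-- `R = ⨁ₙ 𝒜 n` is a standard graded algebra over the field `k`: `R` is nonzero, the degree zero
part is `k`, and `R` is generated as a `k`-algebra by the finite-dimensional space `𝒜 1`. -/
structure IsStandardGraded (𝒜 : ℕ → Submodule k R) [GradedAlgebra 𝒜] : Prop where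
  nontrivial : Nontrivial R
  degree_zero : 𝒜 0 = 1
  adjoin_degree_one : Algebra.adjoin k (𝒜 1 : Set R) = ⊤
  finite_degree_one : FiniteDimensional k (𝒜 1)

/-- The ideal `I` is generated by forms of degree `d`. -/
def IsEquigenerated (𝒜 : ℕ → Submodule k R) (I : Ideal R) (d : ℕ) : Prop :=
  ∃ S : Set R, S ⊆ 𝒜 d ∧ I = Ideal.span S

/-- The degree `n` part `[I]ₙ = I ∩ Rₙ` of an ideal. -/
def degreePart (𝒜 : ℕ → Submodule k R) (I : Ideal R) (n : ℕ) : Submodule k R :=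
  I.restrictScalars k ⊓ 𝒜 n

/-- The special fiber `ℱ(I) = R[It] / 𝔪 R[It]`, where `𝔪 = R₊`. -/
abbrev SpecialFiber (𝒜 : ℕ → Submodule k R) [GradedAlgebra 𝒜] (I : Ideal R) : Type _ :=
  reesAlgebra I ⧸ (HomogeneousIdeal.irrelevant 𝒜).toIdeal.map (algebraMap R (reesAlgebra I))

/-- The analytic spread `ℓ(I)`: the Krull dimension of the special fiber. -/
noncomputable def analyticSpread (𝒜 : ℕ → Submodule k R) [GradedAlgebra 𝒜] (I : Ideal R) :
    WithBot ℕ∞ :=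
  ringKrullDim (SpecialFiber 𝒜 I)

/-- The sequence `f₁, …, f_ℓ`, with `ℓ = m + 1`, is analytically tight in power `n`
with respect to the ideal `I` generated in degree `d`:
`[((f₁, …, f_{ℓ-1}) : f_ℓ) ∩ Iⁿ]_{nd} = [(f₁, …, f_{ℓ-1}) ∩ Iⁿ]_{nd}`.
It is meant for forms `fᵢ ∈ [I]_d` and `ℓ = ℓ(I)`. -/
def IsAnalyticallyTightInPower (𝒜 : ℕ → Submodule k R) (I : Ideal R) (d : ℕ) {m : ℕ}
    (f : Fin (m + 1) → R) (n : ℕ) : Prop :=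
  degreePart 𝒜
      ((Ideal.span (Set.range fun i : Fin m => f i.castSucc)).colon {f (Fin.last m)} ⊓ I ^ n)
      (n * d) =
    degreePart 𝒜 (Ideal.span (Set.range fun i : Fin m => f i.castSucc) ⊓ I ^ n) (n * d)

/-- Analytically tight: analytically tight in every power `n ≥ 1`. -/
def IsAnalyticallyTight (𝒜 : ℕ → Submodule k R) (I : Ideal R) (d : ℕ) {m : ℕ}
    (f : Fin (m + 1) → R) : Prop :=
  ∀ n : ℕ, 1 ≤ n → IsAnalyticallyTightInPower 𝒜 I d f n

end Graded

end FiberCone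

/-! Suppose d > 0. Since I is generated in degree d, the special fiber is a graded k-algebra whose
n-th piece is [Iⁿ]_{nd}, and the fᵢ give linear forms uᵢ = fᵢt in it. Everything rests on one degree
count: Iⁿ⁺¹ lives in degrees ≥ (n+1)d > nd, so a congruence modulo Iⁿ⁺¹ becomes an equality in
degree nd.

Applied to relations in gr_I(R), this shows that u₁, …, u_g form a regular sequence in ℱ(I)
(`regSeq_fiberForms`). Applied to the Valabrega–Valla property, it shows that for n ≥ 1 an element
of [Iⁿ]_{nd} lies in (f₁, …, f_s), s ≤ g, exactly when its class lies in (u₁, …, u_s)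
(`fiberClass_mem_span_iff`). Hence analytic tightness says that u_{g+1} is a nonzerodivisor modulo
(u₁, …, u_g) on forms of positive degree.

As J is a reduction, u₁, …, u_{g+1} generate all forms of large degree, so with dim ℱ(I) = g + 1
they are a linear system of parameters. It remains to see that such an algebra is Cohen–Macaulay iff
the system is regular (`isCohenMacaulayRing_iff_of_regSeq`). If it is regular, a maximal ideal P is
handled by replacing uᵢ with pᵢ(uᵢ) ∈ P, where pᵢ is the minimal polynomial of uᵢ modulo P; the
leading forms are powers of the uᵢ, so regularity survives. If it is not, the quotient by (u₁, …,
u_g) has a socle element, and the localization at the irrelevant ideal has depth ≤ g but dimension >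
g.

When d = 0, I is zero and the degree can be changed to 1. -/

namespace FiberCone

/-! ### Weakly regular sequences as ideal membership, and their powers -/

section RegularSequences

open RingTheory.Sequence Function
open scoped Pointwise

variable {A : Type*} [CommRing A]

/-- The first `n` terms of `u` form a weakly regular sequence, in terms of ideal membership. -/
def RegSeq (u : ℕ → A) (n : ℕ) : Prop :=
  ∀ s < n, ∀ a : A, u s * a ∈ Ideal.span (u '' Set.Iio s) → a ∈ Ideal.span (u '' Set.Iio s)

theorem ofList_map_range (u : ℕ → A) (s : ℕ) :
    Ideal.ofList ((List.range s).map u) = Ideal.span (u '' Set.Iio s) := by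
  unfold Ideal.ofList
  congr 1
  ext x
  simp

theorem isWeaklyRegular_map_range_iff (u : ℕ → A) (n : ℕ) :
    IsWeaklyRegular A ((List.range n).map u) ↔ RegSeq u n := by
  have key : ∀ s < n, Ideal.ofList (((List.range n).map u).take s) = Ideal.span (u '' Set.Iio s) := by
    intro s hs
    rw [← List.map_take, List.take_range, min_eq_left hs.le, ofList_map_range]
  rw [isWeaklyRegular_iff]
  constructor
  · intro h s hs a ha
    have := h s (by simpa using hs)
    rw [isSMulRegular_quotient_iff_mem_of_smul_mem, smul_eq_mul, Ideal.mul_top, key s hs] at this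
    exact this a (by simpa using ha)
  · intro h s hs
    have hs' : s < n := by simpa using hs
    rw [isSMulRegular_quotient_iff_mem_of_smul_mem, smul_eq_mul, Ideal.mul_top, key s hs']
    intro a ha
    exact h s hs' a (by simpa using ha)

theorem span_image_Iio_succ (u : ℕ → A) (s : ℕ) :
    Ideal.span (u '' Set.Iio (s + 1)) = Ideal.span (u '' Set.Iio s) ⊔ Ideal.span {u s} := by
  rw [← Ideal.span_union, ← Set.image_singleton, ← Set.image_union]
  congr 2
  ext x
  simp

theorem mem_span_image_Iio_iff {u : ℕ → A} {s : ℕ} {y : A} :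
    y ∈ Ideal.span (u '' Set.Iio s) ↔ ∃ c : ℕ → A, y = ∑ i ∈ Finset.range s, u i * c i := by
  constructor
  · intro h
    rw [← Finset.coe_range, Submodule.mem_span_image_finset_iff_exists_fun] at h
    obtain ⟨c, hc⟩ := h
    refine ⟨fun i => if h : i ∈ Finset.range s then c ⟨i, h⟩ else 0, ?_⟩
    rw [← Finset.sum_coe_sort, ← hc]
    exact Finset.sum_congr rfl fun i _ => by simp [mul_comm]
  · rintro ⟨c, rfl⟩
    exact Ideal.sum_mem _ fun i hi => Ideal.mul_mem_right _ _
      (Ideal.subset_span ⟨i, by simpa using hi, rfl⟩)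

theorem sum_mul_mem_span {u : ℕ → A} {s : ℕ} (c : ℕ → A) :
    ∑ i ∈ Finset.range s, u i * c i ∈ Ideal.span (u '' Set.Iio s) :=
  mem_span_image_Iio_iff.2 ⟨c, rfl⟩

/-- Regularity of r on the outer terms gives it on the middle one, and regularity on P keeps the
sequence short exact modulo r, so induction on the list applies. -/
theorem isWeaklyRegular_of_shortExact {N M P : Type*} [AddCommGroup N] [AddCommGroup M]
    [AddCommGroup P] [Module A N] [Module A M] [Module A P] {rs : List A}
    (f : N →ₗ[A] M) (g : M →ₗ[A] P) (hf : Injective f) (hfg : Exact f g) (hg : Surjective g)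
    (hN : IsWeaklyRegular N rs) (hP : IsWeaklyRegular P rs) : IsWeaklyRegular M rs := by
  induction hN generalizing M P with
  | nil => exact .nil A M
  | @cons N' _ _ r rs hr hN ih =>
    rw [isWeaklyRegular_cons_iff] at hP ⊢
    refine ⟨?_, ?_⟩
    · intro x y hxy
      have h1 : g (x - y) = 0 := by
        refine hP.1 ?_
        change r • g (x - y) = r • 0
        rw [← map_smul, smul_sub, smul_zero, map_sub, sub_eq_zero]
        exact congrArg g hxy
      obtain ⟨z, hz⟩ := (hfg _).1 h1
      have h2 : r • z = r • 0 := hf (by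
        rw [map_smul, hz, smul_sub, smul_zero, map_zero, sub_eq_zero]
        exact hxy)
      have h3 : z = 0 := hr h2
      rwa [h3, map_zero, eq_comm, sub_eq_zero] at hz
    · refine ih (QuotSMulTop.map r f) (QuotSMulTop.map r g) ?_ (QuotSMulTop.map_exact r hfg hg)
        (QuotSMulTop.map_surjective r hg) hP.2
      have h0 : Exact (0 : N' →ₗ[A] N') f := by
        intro x
        simp [hf.eq_iff' (map_zero f), eq_comm]
      have := QuotSMulTop.map_first_exact_on_four_term_exact_of_isSMulRegular_last
        (r := r) h0 hfg hP.1
      rw [← LinearMap.ker_eq_bot, this.linearMap_ker_eq]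
      simp

/-- Induction on d along 0 → M/xᵈM → M/xᵈ⁺¹M → M/xM → 0, whose first map is multiplication by x; it
is injective because x is regular on M. -/
theorem isWeaklyRegular_quotSMulTop_pow {M : Type*} [AddCommGroup M] [Module A M] {x : A}
    {rs : List A} (hx : IsSMulRegular M x) (h : IsWeaklyRegular (QuotSMulTop x M) rs) (d : ℕ) :
    IsWeaklyRegular (QuotSMulTop (x ^ d) M) rs := by
  induction d with
  | zero =>
    have : Subsingleton (QuotSMulTop (x ^ 0) M) := by
      rw [pow_zero]
      exact Submodule.Quotient.subsingleton_iff.2 (by simp)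
    rw [isWeaklyRegular_iff]
    intro i hi a b _
    have : Subsingleton (QuotSMulTop (x ^ 0) M ⧸
      (Ideal.ofList (rs.take i) • ⊤ : Submodule A (QuotSMulTop (x ^ 0) M))) := inferInstance
    exact Subsingleton.elim _ _
  | succ d ih =>
    have h1 : x ^ d • (⊤ : Submodule A M) ≤ (x ^ (d + 1) • (⊤ : Submodule A M)).comap
        (LinearMap.lsmul A M x) := by
      intro m hm
      obtain ⟨y, -, rfl⟩ := hm
      exact ⟨y, trivial, by simpa [pow_succ', mul_smul] using smul_comm _ _ _⟩
    have h2 : x ^ (d + 1) • (⊤ : Submodule A M) ≤ (x • (⊤ : Submodule A M)).comap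
        LinearMap.id := by
      intro m hm
      obtain ⟨y, -, rfl⟩ := hm
      exact ⟨x ^ d • y, trivial, by simpa [pow_succ', mul_smul] using smul_comm _ _ _⟩
    refine isWeaklyRegular_of_shortExact
      (Submodule.mapQ _ _ _ h1 : QuotSMulTop (x ^ d) M →ₗ[A] QuotSMulTop (x ^ (d + 1)) M)
      (Submodule.mapQ _ _ _ h2 : QuotSMulTop (x ^ (d + 1)) M →ₗ[A] QuotSMulTop x M) ?_ ?_ ?_ ih h
    · rw [injective_iff_map_eq_zero]
      intro m hm
      obtain ⟨m, rfl⟩ := Submodule.Quotient.mk_surjective _ m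
      rw [Submodule.mapQ_apply, Submodule.Quotient.mk_eq_zero] at hm
      obtain ⟨y, -, hy⟩ := hm
      rw [Submodule.Quotient.mk_eq_zero]
      refine ⟨y, trivial, hx ?_⟩
      simpa [pow_succ', mul_smul] using hy
    · intro m
      obtain ⟨m, rfl⟩ := Submodule.Quotient.mk_surjective _ m
      rw [Submodule.mapQ_apply, Submodule.Quotient.mk_eq_zero]
      constructor
      · rintro ⟨y, -, hy⟩
        refine ⟨Submodule.Quotient.mk y, ?_⟩
        rw [Submodule.mapQ_apply]
        exact congrArg _ hy
      · rintro ⟨y, hy⟩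
        obtain ⟨y, rfl⟩ := Submodule.Quotient.mk_surjective _ y
        rw [Submodule.mapQ_apply, Submodule.Quotient.eq] at hy
        obtain ⟨z, -, hz⟩ := hy
        refine ⟨y - x ^ d • z, trivial, ?_⟩
        simp only [DistribSMul.toLinearMap_apply, LinearMap.lsmul_apply, LinearMap.id_apply,
          pow_succ', mul_smul] at hz ⊢
        rw [smul_sub, hz, sub_sub_cancel]
    · intro m
      obtain ⟨m, rfl⟩ := Submodule.Quotient.mk_surjective _ m
      exact ⟨Submodule.Quotient.mk m, rfl⟩

/-- The tail is raised to powers over M/xM first, and only then is x replaced by its power. The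
sequence is never permuted. -/
theorem isWeaklyRegular_map_pow {M : Type*} [AddCommGroup M] [Module A M] (l : List (A × ℕ))
    (h : IsWeaklyRegular M (l.map Prod.fst)) :
    IsWeaklyRegular M (l.map fun p => p.1 ^ p.2) := by
  induction l generalizing M with
  | nil => exact .nil A M
  | cons p l ih =>
    rw [List.map_cons, isWeaklyRegular_cons_iff] at h ⊢
    exact ⟨h.1.pow p.2, isWeaklyRegular_quotSMulTop_pow h.1 (ih h.2) p.2⟩

theorem RegSeq.pow {u : ℕ → A} {n : ℕ} (h : RegSeq u n) (d : ℕ → ℕ) :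
    RegSeq (fun i => u i ^ d i) n := by
  rw [← isWeaklyRegular_map_range_iff] at h ⊢
  have := isWeaklyRegular_map_pow (M := A) ((List.range n).map fun i => (u i, d i))
    (by simpa [Function.comp_def] using h)
  simpa [Function.comp_def] using this

end RegularSequences

/-! ### Regularity of initial forms with respect to a filtration -/

section Filtration

variable {A : Type*} [CommRing A]

/-- The element `y` of filtration degree `N` has its initial form in the ideal generated by the
initial forms of `u 0, …, u (s - 1)`, where `u i` has filtration degree `e i`. -/
def InitMem (G : ℤ → AddSubgroup A) (u : ℕ → A) (e : ℕ → ℤ) (s : ℕ) (N : ℤ) (y : A) : Prop :=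
  ∃ c : ℕ → A, (∀ i < s, c i ∈ G (N - e i)) ∧ y - ∑ i ∈ Finset.range s, u i * c i ∈ G (N + 1)

/-- If the initial forms of `u 0, …, u (n - 1)` form a regular sequence, then they generate the
initial ideal. -/
theorem initMem_of_mem_span {G : ℤ → AddSubgroup A} (hanti : Antitone G)
    (hmul : ∀ m n x y, x ∈ G m → y ∈ G n → x * y ∈ G (m + n)) (hex : ∀ x, ∃ m, x ∈ G m)
    {u : ℕ → A} {e : ℕ → ℤ} {n : ℕ} (hu : ∀ i < n, u i ∈ G (e i))
    (H : ∀ s < n, ∀ M, ∀ b ∈ G M, InitMem G u e s (M + e s) (u s * b) → InitMem G u e s M b)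
    {s : ℕ} (hs : s ≤ n) {N : ℤ} {y : A} (hy : y ∈ G N)
    (hmem : y ∈ Ideal.span (u '' Set.Iio s)) : InitMem G u e s N y := by
  induction s generalizing N y with
  | zero =>
    have : y = 0 := by simpa using hmem
    exact ⟨0, by simp, by simp [this]⟩
  | succ s ih =>
    have ih := fun {N y} => @ih (Nat.le_of_succ_le hs) N y
    -- `j` bounds how far `u s * b` falls short of degree `N`. While it falls short, the lowest
    -- forms of `z` and `u s * b` cancel, so `H` rewrites `b`, modulo the earlier `u i`, as an
    -- element one degree deeper.
    have main : ∀ j : ℕ, ∀ M : ℤ, N ≤ M + e s + j → ∀ z ∈ Ideal.span (u '' Set.Iio s),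
        ∀ b ∈ G M, y = z + u s * b → InitMem G u e (s + 1) N y := by
      intro j
      induction j with
      | zero =>
        intro M hM z hz b hb hyz
        have hub : u s * b ∈ G (e s + M) := hmul _ _ _ _ (hu s hs) hb
        have hzN : z ∈ G N := by
          rw [eq_sub_of_add_eq hyz.symm]
          exact sub_mem hy (hanti (by push_cast at hM; omega) hub)
        obtain ⟨c, hc, hc'⟩ := ih hzN hz
        refine ⟨Function.update c s b, ?_, ?_⟩
        · intro i hi
          rcases Nat.lt_succ_iff_lt_or_eq.1 hi with hi | rfl
          · rw [Function.update_of_ne hi.ne]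
            exact hc i hi
          · rw [Function.update_self]
            exact hanti (by push_cast at hM; omega) hb
        · rw [Finset.sum_range_succ, Function.update_self,
            Finset.sum_congr rfl fun i hi => by
              rw [Function.update_of_ne (Finset.mem_range.1 hi).ne]]
          convert hc' using 1
          rw [hyz]
          ring
      | succ j ihj =>
        intro M hM z hz b hb hyz
        rcases le_or_gt N (M + e s + j) with hle | hlt
        · exact ihj M hle z hz b hb hyz
        have hub : u s * b ∈ G (M + e s) := add_comm (e s) M ▸ hmul _ _ _ _ (hu s hs) hb
        have hzM : z ∈ G (M + e s) := by
          rw [eq_sub_of_add_eq hyz.symm]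
          exact sub_mem (hanti (by omega) hy) hub
        obtain ⟨c, hc, hc'⟩ := ih hzM hz
        have hy' : y ∈ G (M + e s + 1) := hanti (by omega) hy
        obtain ⟨c', hcm, hcb⟩ := H s hs M b hb ⟨fun i => - c i, fun i hi => neg_mem (hc i hi), by
          have := sub_mem hy' hc'
          convert this using 1
          rw [hyz]
          simp only [mul_neg, Finset.sum_neg_distrib]
          ring⟩
        refine ihj (M + 1) (by push_cast at hM; omega)
          (z + u s * ∑ i ∈ Finset.range s, u i * c' i)
          (add_mem hz (Ideal.mul_mem_left _ _ (sum_mul_mem_span c'))) _ hcb ?_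
        rw [hyz]
        ring
    rw [span_image_Iio_succ, Submodule.mem_sup] at hmem
    obtain ⟨z, hz, w, hw, rfl⟩ := hmem
    obtain ⟨b, rfl⟩ := Ideal.mem_span_singleton'.1 hw
    obtain ⟨M, hM⟩ := hex b
    exact main (N - (M + e s)).toNat M (by omega) z hz b hM (by ring)

/-- If the initial forms of a sequence are regular for a filtration that is zero in large degree,
then the sequence is regular. -/
theorem regSeq_of_initMem {G : ℤ → AddSubgroup A} (hanti : Antitone G)
    (hmul : ∀ m n x y, x ∈ G m → y ∈ G n → x * y ∈ G (m + n)) (hex : ∀ x, ∃ m, x ∈ G m)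
    {u : ℕ → A} {e : ℕ → ℤ} {n : ℕ} (hu : ∀ i < n, u i ∈ G (e i))
    (H : ∀ s < n, ∀ M, ∀ b ∈ G M, InitMem G u e s (M + e s) (u s * b) → InitMem G u e s M b)
    {T : ℤ} (hT : G T = ⊥) : RegSeq u n := by
  intro s hs a ha
  -- Modulo the ideal, `a` is pushed one filtration step deeper each time, until it reaches `G T =
  -- ⊥`.
  have main : ∀ j : ℕ, ∀ M : ℤ, T ≤ M + j → ∀ a ∈ G M, u s * a ∈ Ideal.span (u '' Set.Iio s) →
      a ∈ Ideal.span (u '' Set.Iio s) := by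
    intro j
    induction j with
    | zero =>
      intro M hM a ha _
      have : a ∈ G T := hanti (by simpa using hM) ha
      rw [hT, AddSubgroup.mem_bot] at this
      simp [this]
    | succ j ih =>
      intro M hM a ha hua
      obtain ⟨c, -, hc⟩ := H s hs M a ha (initMem_of_mem_span hanti hmul hex hu H hs.le
        (add_comm (e s) M ▸ hmul _ _ _ _ (hu s hs) ha) hua)
      have := ih (M + 1) (by push_cast at hM; omega) _ hc (by
        rw [mul_sub]
        exact sub_mem hua (Ideal.mul_mem_left _ _ (sum_mul_mem_span c)))
      simpa using add_mem this (sum_mul_mem_span c)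
  obtain ⟨M, hM⟩ := hex a
  exact main (T - M).toNat M (by omega) a hM ha

end Filtration

/-! ### Depth of a Noetherian local ring: maximal regular sequences have equal length -/

section LocalDepth

open IsLocalRing RingTheory.Sequence

variable {L : Type*} [CommRing L]

/-- `x` is a nonzerodivisor modulo the ideal `J`. -/
def RegMod (J : Ideal L) (x : L) : Prop := ∀ a, x * a ∈ J → a ∈ J

/-- A relation xw ≡ vz modulo J forces v ∈ J + (x) because z is regular there; cancelling x then
puts w in J + (z). -/
theorem RegMod.swap {J : Ideal L} {x z : L} (hx : RegMod J x) (hz : RegMod (J ⊔ Ideal.span {x}) z) :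
    RegMod (J ⊔ Ideal.span {z}) x := by
  intro w hw
  obtain ⟨α, hα, t, ht, h⟩ := Submodule.mem_sup.1 hw
  obtain ⟨v, rfl⟩ := Ideal.mem_span_singleton'.1 ht
  have hv : z * -v ∈ J ⊔ Ideal.span {x} := by
    have : z * -v = α - w * x := by rw [mul_comm w, ← h]; ring
    rw [this]
    exact sub_mem (Ideal.mem_sup_left hα)
      (Ideal.mem_sup_right (Ideal.mul_mem_left _ _ (Ideal.mem_span_singleton_self x)))
  obtain ⟨β, hβ, t, ht, h'⟩ := Submodule.mem_sup.1 (hz _ hv)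
  obtain ⟨v', rfl⟩ := Ideal.mem_span_singleton'.1 ht
  have h1 : w + z * v' ∈ J := by
    refine hx _ ?_
    have : x * (w + z * v') = α - z * β := by
      linear_combination -h + z * h'
    rw [this]
    exact sub_mem hα (Ideal.mul_mem_left _ _ hβ)
  have : w = (w + z * v') - v' * z := by ring
  rw [this]
  exact sub_mem (Ideal.mem_sup_left h1)
    (Ideal.mem_sup_right (Ideal.mul_mem_left _ _ (Ideal.mem_span_singleton_self z)))

theorem exists_regSeq_of_isRegular {rs : List L} (h : IsRegular L rs) :
    ∃ y : ℕ → L, RegSeq y rs.length ∧ (List.range rs.length).map y = rs := by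
  have : (List.range rs.length).map (fun i => rs.getD i 0) = rs := by
    refine List.ext_getElem (by simp) fun i h1 h2 => ?_
    simp [h2]
  refine ⟨fun i => rs.getD i 0, ?_, this⟩
  rw [← isWeaklyRegular_map_range_iff, this]
  exact h.toIsWeaklyRegular

variable [IsLocalRing L]

/-- `J` is a proper ideal such that the maximal ideal is associated to `L ⧸ J`. -/
def HasSocle (J : Ideal L) : Prop := ∃ z, z ∉ J ∧ ∀ a ∈ maximalIdeal L, a * z ∈ J

theorem HasSocle.not_regMod {J : Ideal L} (h : HasSocle J) {x : L} (hx : x ∈ maximalIdeal L) :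
    ¬ RegMod J x := by
  obtain ⟨z, hz, hm⟩ := h
  exact fun hr => hz (hr z (hm x hx))

/-- Both socles compute Ext¹ of the residue field into L/J. Concretely, a socle element z modulo x
satisfies yz ≡ wx modulo J, and w is a socle element modulo y. -/
theorem HasSocle.exchange {J : Ideal L} {x y : L} (hx : RegMod J x) (hy : RegMod J y)
    (hym : y ∈ maximalIdeal L) (h : HasSocle (J ⊔ Ideal.span {x})) :
    HasSocle (J ⊔ Ideal.span {y}) := by
  obtain ⟨z, hz, hm⟩ := h
  obtain ⟨α, hα, t, ht, h⟩ := Submodule.mem_sup.1 (hm y hym)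
  obtain ⟨w, rfl⟩ := Ideal.mem_span_singleton'.1 ht
  refine ⟨w, ?_, ?_⟩
  · intro hw
    obtain ⟨β, hβ, t, ht, h'⟩ := Submodule.mem_sup.1 hw
    obtain ⟨w', rfl⟩ := Ideal.mem_span_singleton'.1 ht
    have h1 : z - x * w' ∈ J := by
      refine hy _ ?_
      have : y * (z - x * w') = α + x * β := by linear_combination -h - x * h'
      rw [this]
      exact add_mem hα (Ideal.mul_mem_left _ _ hβ)
    refine hz ?_
    have : z = (z - x * w') + w' * x := by ring
    rw [this]
    exact add_mem (Ideal.mem_sup_left h1)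
      (Ideal.mem_sup_right (Ideal.mul_mem_left _ _ (Ideal.mem_span_singleton_self x)))
  · intro a ha
    obtain ⟨γ, hγ, t, ht, h'⟩ := Submodule.mem_sup.1 (hm a ha)
    obtain ⟨b, rfl⟩ := Ideal.mem_span_singleton'.1 ht
    have h1 : a * w - b * y ∈ J := by
      refine hx _ ?_
      have : x * (a * w - b * y) = y * γ - a * α := by linear_combination a * h - y * h'
      rw [this]
      exact sub_mem (Ideal.mul_mem_left _ _ hγ) (Ideal.mul_mem_left _ _ hα)
    have : a * w = (a * w - b * y) + b * y := by ring
    rw [this]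
    exact add_mem (Ideal.mem_sup_left h1)
      (Ideal.mem_sup_right (Ideal.mul_mem_left _ _ (Ideal.mem_span_singleton_self y)))

/-- Over a Noetherian local ring, finitely many ideals whose quotients have positive depth admit a
common nonzerodivisor in the maximal ideal. -/
theorem exists_regMod [IsNoetherianRing L] {ι : Type*} [Finite ι] (J : ι → Ideal L)
    (hJ : ∀ i, ¬ HasSocle (J i)) : ∃ z ∈ maximalIdeal L, ∀ i, RegMod (J i) z := by
  have hfin : (⋃ i, associatedPrimes L (L ⧸ J i)).Finite :=
    Set.finite_iUnion fun i => associatedPrimes.finite L (L ⧸ J i)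
  -- Prime avoidance: otherwise the maximal ideal would itself be associated to some `L ⧸ J i`, and
  -- so would give a socle element.
  have hnot : ¬ (maximalIdeal L : Set L) ⊆ ⋃ P ∈ hfin.toFinset, (P : Set L) := by
    intro hsub
    obtain ⟨P, hP, hle⟩ := (Ideal.subset_union_prime (s := hfin.toFinset) (f := id) ⊥ ⊥ (by
      intro P hP _ _
      obtain ⟨i, hi⟩ := Set.mem_iUnion.1 (hfin.mem_toFinset.1 hP)
      exact hi.isPrime)).1 hsub
    obtain ⟨i, hi⟩ := Set.mem_iUnion.1 (hfin.mem_toFinset.1 hP)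
    have hPm : P = maximalIdeal L := le_antisymm (le_maximalIdeal hi.isPrime.ne_top) hle
    obtain ⟨-, x, hx⟩ := (isAssociatedPrime_iff ..).1 hi
    obtain ⟨x, rfl⟩ := Ideal.Quotient.mk_surjective x
    have hiff : ∀ a, a ∈ maximalIdeal L ↔ a * x ∈ J i := by
      intro a
      rw [← hPm, hx, Submodule.mem_colon_singleton, Submodule.mem_bot, Algebra.smul_def,
        Ideal.Quotient.algebraMap_eq, ← map_mul, Ideal.Quotient.eq_zero_iff_mem]
    refine hJ i ⟨x, fun h => ?_, fun a ha => (hiff a).1 ha⟩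
    exact (Ideal.ne_top_iff_one _).1 (maximalIdeal.isMaximal L).ne_top
      ((hiff 1).2 (by simpa using h))
  obtain ⟨z, hz, hzn⟩ := Set.not_subset.1 hnot
  refine ⟨z, hz, fun i => ?_⟩
  have h1 : z ∉ ⋃ P ∈ associatedPrimes L (L ⧸ J i), (P : Set L) := by
    intro h
    apply hzn
    simp only [Set.mem_iUnion, Set.Finite.mem_toFinset] at h ⊢
    obtain ⟨P, hP, h⟩ := h
    exact ⟨P, ⟨i, hP⟩, h⟩
  rw [biUnion_associatedPrimes_eq_compl_regular, Set.notMem_compl_iff] at h1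
  exact (isSMulRegular_quotient_iff_mem_of_smul_mem _ _).1 h1

/-- There is a maximal regular sequence of length `r` modulo `J`. -/
def HasMaxReg : ℕ → Ideal L → Prop
  | 0, J => HasSocle J
  | r + 1, J => ∃ x ∈ maximalIdeal L, RegMod J x ∧ HasMaxReg r (J ⊔ Ideal.span {x})

/-- The length is independent of the first element. One passes from x to y through an element z
regular modulo J, J + (x) and J + (y) at once: the induction hypothesis goes from J + (x) to J + (x,
z), and from J + (z) to J + (z, y); `RegMod.swap` supplies the regularity in between. -/
theorem HasMaxReg.sup_span [IsNoetherianRing L] {r : ℕ} {J : Ideal L} (h : HasMaxReg (r + 1) J)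
    {y : L} (hym : y ∈ maximalIdeal L) (hy : RegMod J y) :
    HasMaxReg r (J ⊔ Ideal.span {y}) := by
  induction r generalizing J y with
  | zero =>
    obtain ⟨x, -, hx, h⟩ := h
    exact HasSocle.exchange hx hy hym h
  | succ r ih =>
    obtain ⟨x, hxm, hx, h⟩ := h
    have h' := h
    obtain ⟨x₂, hx₂m, hx₂, -⟩ := h'
    have hsx : ¬ HasSocle (J ⊔ Ideal.span {x}) := fun hs => hs.not_regMod hx₂m hx₂
    have hsy : ¬ HasSocle (J ⊔ Ideal.span {y}) := fun hs => hsx (hs.exchange hy hx hxm)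
    obtain ⟨z, hzm, hz⟩ := exists_regMod
      (fun i : Fin 3 => ![J, J ⊔ Ideal.span {x}, J ⊔ Ideal.span {y}] i) (by
        intro i
        fin_cases i
        · exact fun hs => hs.not_regMod hxm hx
        · exact hsx
        · exact hsy)
    have hz0 : RegMod J z := hz 0
    have hzx : RegMod (J ⊔ Ideal.span {x}) z := hz 1
    have hzy : RegMod (J ⊔ Ideal.span {y}) z := hz 2
    have h1 := ih h hzm hzx
    rw [sup_right_comm] at h1
    have h2 := ih ⟨x, hxm, hx.swap hzx, h1⟩ hym (hy.swap hzy)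
    rw [sup_right_comm] at h2
    exact ⟨z, hzm, hzy, h2⟩

theorem HasMaxReg.le_of_regSeq [IsNoetherianRing L] {r : ℕ} (h : HasMaxReg r (⊥ : Ideal L))
    {y : ℕ → L} {s : ℕ} (hym : ∀ i < s, y i ∈ maximalIdeal L) (hy : RegSeq y s) : s ≤ r := by
  have main : ∀ i ≤ s, ∃ q, r = q + i ∧ HasMaxReg q (Ideal.span (y '' Set.Iio i)) := by
    intro i
    induction i with
    | zero => exact fun _ => ⟨r, rfl, by simpa using h⟩
    | succ i ih =>
      intro hi
      obtain ⟨q, hq, hr⟩ := ih (Nat.le_of_succ_le hi)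
      have hreg : RegMod (Ideal.span (y '' Set.Iio i)) (y i) := hy i hi
      cases q with
      | zero => exact absurd hreg (HasSocle.not_regMod hr (hym i hi))
      | succ q =>
        refine ⟨q, by omega, ?_⟩
        rw [span_image_Iio_succ]
        exact hr.sup_span (hym i hi) hreg
  obtain ⟨q, hq, -⟩ := main s le_rfl
  omega

theorem HasMaxReg.of_regSeq {r : ℕ} {y : ℕ → L} (hym : ∀ i < r, y i ∈ maximalIdeal L)
    (hy : RegSeq y r) (h : HasSocle (Ideal.span (y '' Set.Iio r))) :
    HasMaxReg r (⊥ : Ideal L) := by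
  have main : ∀ q i, i + q = r → HasMaxReg q (Ideal.span (y '' Set.Iio i)) := by
    intro q
    induction q with
    | zero => rintro i rfl; exact h
    | succ q ih =>
      intro i hi
      refine ⟨y i, hym i (by omega), hy i (by omega), ?_⟩
      rw [← span_image_Iio_succ]
      exact ih _ (by omega)
  simpa using main r 0 (by simp)

/-- If the maximal ideal is associated to the quotient by a regular sequence of length `r`, then the
depth is at most `r`. -/
theorem depth_le_of_hasSocle [IsNoetherianRing L] {r : ℕ} {u : ℕ → L}
    (hum : ∀ i < r, u i ∈ maximalIdeal L) (hu : RegSeq u r)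
    (h : HasSocle (Ideal.span (u '' Set.Iio r))) : depth L ≤ r := by
  refine iSup_le fun ⟨rs, hm, hrs⟩ => ?_
  obtain ⟨y, hy, hyl⟩ := exists_regSeq_of_isRegular hrs
  refine Nat.cast_le.2 ((HasMaxReg.of_regSeq hum hu h).le_of_regSeq (y := y) (fun i hi => ?_) hy)
  have : y i ∈ (List.range rs.length).map y := List.mem_map.2 ⟨i, List.mem_range.2 hi, rfl⟩
  exact hm _ (hyl ▸ this)

theorem le_depth_of_regSeq {r : ℕ} {u : ℕ → L} (hum : ∀ i < r, u i ∈ maximalIdeal L)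
    (hu : RegSeq u r) [IsNoetherianRing L] : (r : ℕ∞) ≤ depth L := by
  have hm : ∀ x ∈ (List.range r).map u, x ∈ maximalIdeal L := by
    intro x hx
    obtain ⟨i, hi, rfl⟩ := List.mem_map.1 hx
    exact hum i (List.mem_range.1 hi)
  refine le_trans ?_ (le_iSup (fun rs : {rs : List L // (∀ r ∈ rs, r ∈ maximalIdeal L) ∧
    IsRegular L rs} => (rs.1.length : ℕ∞)) ⟨(List.range r).map u, hm,
      (IsLocalRing.isRegular_iff_isWeaklyRegular_of_subset_maximalIdeal hm).2
        ((isWeaklyRegular_map_range_iff u r).2 hu)⟩)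
  rw [List.length_map, List.length_range]

theorem depth_le_ringKrullDim [IsNoetherianRing L] :
    ((depth L : ℕ∞) : WithBot ℕ∞) ≤ ringKrullDim L := by
  have hfin : ringKrullDim L = ((maximalIdeal L).height : WithBot ℕ∞) :=
    maximalIdeal_height_eq_ringKrullDim.symm
  rw [hfin, WithBot.coe_le_coe]
  refine iSup_le fun ⟨rs, hm, hrs⟩ => ?_
  rw [← WithBot.coe_le_coe, ← hfin, ← ringKrullDim_add_length_eq_ringKrullDim_of_isRegular rs hrs]
  have : Nontrivial (L ⧸ Ideal.ofList rs) := by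
    refine Ideal.Quotient.nontrivial_iff.2 fun htop => hrs.top_ne_smul ?_
    rw [htop]
    simp
  simpa using add_le_add_left (ringKrullDim_nonneg_of_nontrivial (R := L ⧸ Ideal.ofList rs))
    (rs.length : WithBot ℕ∞)

end LocalDepth

/-! ### Homogeneous components, leading forms, and polynomials in linear forms -/

section GradedAlgebra

variable {k A : Type*} [Field k] [CommRing A] [Algebra k A] (𝓐 : ℕ → Submodule k A)
  [GradedAlgebra 𝓐]

theorem proj_apply_of_mem {n : ℕ} {a : A} (ha : a ∈ 𝓐 n) : GradedAlgebra.proj 𝓐 n a = a := by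
  rw [GradedAlgebra.proj_apply, DirectSum.decompose_of_mem_same 𝓐 ha]

theorem proj_apply_of_mem_of_ne {n m : ℕ} {a : A} (ha : a ∈ 𝓐 n) (hnm : n ≠ m) :
    GradedAlgebra.proj 𝓐 m a = 0 := by
  rw [GradedAlgebra.proj_apply, DirectSum.decompose_of_mem_ne 𝓐 ha hnm]

theorem proj_mem (n : ℕ) (a : A) : GradedAlgebra.proj 𝓐 n a ∈ 𝓐 n := by
  rw [GradedAlgebra.proj_apply]
  exact SetLike.coe_mem _

theorem proj_mul_of_le {d n : ℕ} {a : A} (ha : a ∈ 𝓐 d) (hdn : d ≤ n) (x : A) :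
    GradedAlgebra.proj 𝓐 n (a * x) = a * GradedAlgebra.proj 𝓐 (n - d) x := by
  rw [GradedAlgebra.proj_apply, GradedAlgebra.proj_apply]
  exact DirectSum.coe_decompose_mul_of_left_mem_of_le 𝓐 ha hdn

theorem proj_mul_of_lt {d n : ℕ} {a : A} (ha : a ∈ 𝓐 d) (hdn : n < d) (x : A) :
    GradedAlgebra.proj 𝓐 n (a * x) = 0 := by
  rw [GradedAlgebra.proj_apply]
  exact DirectSum.coe_decompose_mul_of_left_mem_of_not_le 𝓐 ha hdn.not_ge

theorem exists_sum_proj (a : A) :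
    ∃ S : Finset ℕ, a = ∑ n ∈ S, GradedAlgebra.proj 𝓐 n a := by
  classical
  refine ⟨(DirectSum.decompose 𝓐 a).support, ?_⟩
  conv_lhs => rw [← DirectSum.sum_support_decompose 𝓐 a]
  rfl

theorem mem_of_forall_proj_mem {J : Ideal A} {a : A}
    (h : ∀ n, GradedAlgebra.proj 𝓐 n a ∈ J) : a ∈ J := by
  obtain ⟨S, hS⟩ := exists_sum_proj 𝓐 a
  rw [hS]
  exact sum_mem fun n _ => h n

theorem eq_zero_of_forall_proj {a : A} (h : ∀ n, GradedAlgebra.proj 𝓐 n a = 0) : a = 0 := by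
  obtain ⟨S, hS⟩ := exists_sum_proj 𝓐 a
  rw [hS]
  exact Finset.sum_eq_zero fun n _ => h n

/-- The component of an element of an ideal generated by forms is a combination of these forms with
homogeneous coefficients. -/
theorem exists_proj_eq_sum {u : ℕ → A} {d : ℕ → ℕ} {s : ℕ} (hu : ∀ i < s, u i ∈ 𝓐 (d i)) {x : A}
    (hx : x ∈ Ideal.span (u '' Set.Iio s)) (n : ℕ) :
    ∃ c : ℕ → A, (∀ i < s, d i ≤ n → c i ∈ 𝓐 (n - d i)) ∧ (∀ i, n < d i → c i = 0) ∧
      GradedAlgebra.proj 𝓐 n x = ∑ i ∈ Finset.range s, u i * c i := by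
  obtain ⟨c, rfl⟩ := mem_span_image_Iio_iff.1 hx
  refine ⟨fun i => if d i ≤ n then GradedAlgebra.proj 𝓐 (n - d i) (c i) else 0, ?_, ?_, ?_⟩
  · intro i _ hi
    dsimp only
    rw [if_pos hi]
    exact proj_mem 𝓐 _ _
  · intro i hi
    exact if_neg hi.not_ge
  · rw [map_sum]
    refine Finset.sum_congr rfl fun i hi => ?_
    have hui := hu i (Finset.mem_range.1 hi)
    dsimp only
    split_ifs with h
    · exact proj_mul_of_le 𝓐 hui h _
    · rw [mul_zero, proj_mul_of_lt 𝓐 hui (not_le.1 h)]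

theorem proj_mem_span {u : ℕ → A} {d : ℕ → ℕ} {s : ℕ} (hu : ∀ i < s, u i ∈ 𝓐 (d i)) {x : A}
    (hx : x ∈ Ideal.span (u '' Set.Iio s)) (n : ℕ) :
    GradedAlgebra.proj 𝓐 n x ∈ Ideal.span (u '' Set.Iio s) := by
  obtain ⟨c, -, -, hc⟩ := exists_proj_eq_sum 𝓐 hu hx n
  rw [hc]
  exact sum_mul_mem_span c

/-- The elements of degree at most `-m`. -/
def degreeFiltration (m : ℤ) : AddSubgroup A where
  carrier := {x | ∀ n : ℕ, -m < n → GradedAlgebra.proj 𝓐 n x = 0}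
  zero_mem' := fun n _ => map_zero _
  add_mem' := fun hx hy n hn => by rw [map_add, hx n hn, hy n hn, add_zero]
  neg_mem' := fun hx n hn => by rw [map_neg, hx n hn, neg_zero]

theorem degreeFiltration_antitone : Antitone (degreeFiltration 𝓐) :=
  fun _ _ hmn _ hx n hn => hx n (by omega)

theorem exists_mem_degreeFiltration (x : A) : ∃ m, x ∈ degreeFiltration 𝓐 m := by
  classical
  obtain ⟨S, hS⟩ := exists_sum_proj 𝓐 x
  refine ⟨-(S.sup id : ℕ), fun n hn => ?_⟩
  rw [neg_neg, Nat.cast_lt] at hn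
  rw [hS, map_sum]
  refine Finset.sum_eq_zero fun i hi => ?_
  have : i ≤ S.sup id := Finset.le_sup (f := id) hi
  exact proj_apply_of_mem_of_ne 𝓐 (proj_mem 𝓐 i x) (by omega)

theorem degreeFiltration_one : degreeFiltration 𝓐 1 = ⊥ := by
  rw [eq_bot_iff]
  intro x hx
  exact eq_zero_of_forall_proj 𝓐 fun n => hx n (by omega)

theorem mul_mem_degreeFiltration (m n : ℤ) (x y : A) (hx : x ∈ degreeFiltration 𝓐 m)
    (hy : y ∈ degreeFiltration 𝓐 n) : x * y ∈ degreeFiltration 𝓐 (m + n) := by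
  intro j hj
  obtain ⟨S, hS⟩ := exists_sum_proj 𝓐 x
  rw [hS, Finset.sum_mul, map_sum]
  refine Finset.sum_eq_zero fun i _ => ?_
  by_cases hi : -m < i
  · rw [hx i hi, zero_mul, map_zero]
  · rcases le_or_gt i j with hij | hij
    · rw [proj_mul_of_le 𝓐 (proj_mem 𝓐 i x) hij, hy (j - i) (by omega), mul_zero]
    · exact proj_mul_of_lt 𝓐 (proj_mem 𝓐 i x) hij _

/-- Leading components multiply: subtracting the top component of x lowers its degree, and the rest
cannot reach degree m + n. -/
theorem proj_add_mul_of_mem {m n : ℕ} {x y : A} (hx : x ∈ degreeFiltration 𝓐 (-m))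
    (hy : y ∈ degreeFiltration 𝓐 (-n)) : GradedAlgebra.proj 𝓐 (m + n) (x * y) =
      GradedAlgebra.proj 𝓐 m x * GradedAlgebra.proj 𝓐 n y := by
  have hx' : x - GradedAlgebra.proj 𝓐 m x ∈ degreeFiltration 𝓐 (-m + 1) := by
    intro j hj
    rw [map_sub]
    rcases eq_or_ne m j with rfl | hne
    · rw [proj_apply_of_mem 𝓐 (proj_mem 𝓐 m x), sub_self]
    · rw [proj_apply_of_mem_of_ne 𝓐 (proj_mem 𝓐 m x) hne, sub_zero, hx j (by omega)]
  have h1 := mul_mem_degreeFiltration 𝓐 _ _ _ _ hx' hy (m + n) (by push_cast; omega)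
  rw [sub_mul, map_sub, sub_eq_zero] at h1
  rw [h1, proj_mul_of_le 𝓐 (proj_mem 𝓐 m x) (by omega), Nat.add_sub_cancel_left]

theorem proj_aeval {u : A} (hu : u ∈ 𝓐 1) (h : k[X]) (n : ℕ) :
    GradedAlgebra.proj 𝓐 n (aeval u h) = h.coeff n • u ^ n := by
  have hpow : ∀ i, u ^ i ∈ 𝓐 i := fun i => by simpa using SetLike.pow_mem_graded i hu
  rw [aeval_eq_sum_range, map_sum, Finset.sum_eq_single n]
  · rw [map_smul, proj_apply_of_mem 𝓐 (hpow n)]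
  · intro i _ hi
    rw [map_smul, proj_apply_of_mem_of_ne 𝓐 (hpow i) hi, smul_zero]
  · intro hn
    rw [coeff_eq_zero_of_natDegree_lt (by simpa using hn), zero_smul, map_zero]

/-- If linear forms form a regular sequence, then so do their values under monic polynomials. -/
theorem RegSeq.aeval_monic {u : ℕ → A} {n : ℕ} (hu : ∀ i < n, u i ∈ 𝓐 1) (h : RegSeq u n)
    {p : ℕ → k[X]} (hp : ∀ i < n, (p i).Monic) : RegSeq (fun i => aeval (u i) (p i)) n := by
  have hpow := h.pow fun i => (p i).natDegree
  have hup : ∀ i < n, u i ^ (p i).natDegree ∈ 𝓐 (p i).natDegree := fun i hi => by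
    simpa using SetLike.pow_mem_graded (p i).natDegree (hu i hi)
  have hG : ∀ i < n, aeval (u i) (p i) ∈ degreeFiltration 𝓐 (-((p i).natDegree : ℤ)) := by
    intro i hi j hj
    rw [proj_aeval 𝓐 (hu i hi), coeff_eq_zero_of_natDegree_lt (by omega), zero_smul]
  have htop : ∀ i < n, GradedAlgebra.proj 𝓐 (p i).natDegree (aeval (u i) (p i)) =
      u i ^ (p i).natDegree := by
    intro i hi
    rw [proj_aeval 𝓐 (hu i hi), (hp i hi).coeff_natDegree, one_smul]
  -- Degrees are negated to make the filtration decreasing, so "initial" forms are leading forms: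
  -- that of pᵢ(uᵢ) is a power of uᵢ, and `hpow` covers powers.
  refine regSeq_of_initMem (G := degreeFiltration 𝓐) (e := fun i => -((p i).natDegree : ℤ))
    (degreeFiltration_antitone 𝓐) (mul_mem_degreeFiltration 𝓐) (exists_mem_degreeFiltration 𝓐)
    hG ?_ (degreeFiltration_one 𝓐)
  intro s hs M b hb
  rintro ⟨c, hc, hcb⟩
  rcases lt_or_ge 0 M with hM | hM
  · refine ⟨0, fun i _ => zero_mem _, ?_⟩
    have hb0 : b = 0 := eq_zero_of_forall_proj 𝓐 fun j => hb j (by omega)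
    simp only [hb0, Pi.zero_apply, mul_zero, Finset.sum_const_zero, sub_zero]
    exact zero_mem _
  obtain ⟨N, rfl⟩ : ∃ N : ℕ, M = -N := ⟨(-M).toNat, by omega⟩
  have hterm : ∀ i < s, ∃ a, GradedAlgebra.proj 𝓐 ((p s).natDegree + N)
      (aeval (u i) (p i) * c i) = u i ^ (p i).natDegree * a := by
    intro i hi
    have hci : c i ∈ degreeFiltration 𝓐
        (-(N : ℤ) + -((p s).natDegree : ℤ) - -((p i).natDegree : ℤ)) := hc i hi
    rcases le_or_gt (p i).natDegree ((p s).natDegree + N) with hle | hlt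
    · obtain ⟨r, hr⟩ := Nat.exists_eq_add_of_le hle
      refine ⟨GradedAlgebra.proj 𝓐 r (c i), ?_⟩
      rw [hr, proj_add_mul_of_mem 𝓐 (hG i (hi.trans hs)), htop i (hi.trans hs)]
      convert hci using 2
      omega
    · refine ⟨0, ?_⟩
      rw [eq_zero_of_forall_proj 𝓐 fun j => hci j (by omega), mul_zero, mul_zero, map_zero]
  choose! a ha using hterm
  have hmem : GradedAlgebra.proj 𝓐 N b ∈
      Ideal.span ((fun i => u i ^ (p i).natDegree) '' Set.Iio s) := by
    refine hpow s hs _ ?_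
    have h0 := hcb ((p s).natDegree + N) (by push_cast; omega)
    rw [map_sub, sub_eq_zero, proj_add_mul_of_mem 𝓐 (hG s hs) hb, htop s hs, map_sum] at h0
    rw [h0, Finset.sum_congr rfl fun i hi => ha i (Finset.mem_range.1 hi)]
    exact sum_mul_mem_span (u := fun i => u i ^ (p i).natDegree) a
  obtain ⟨c', hc', hc0, hsum⟩ := exists_proj_eq_sum 𝓐
    (fun i hi => hup i (hi.trans hs)) hmem N
  rw [proj_apply_of_mem 𝓐 (proj_mem 𝓐 N b)] at hsum
  have hcG : ∀ i < s, c' i ∈ degreeFiltration 𝓐 (-(N : ℤ) - -((p i).natDegree : ℤ)) := by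
    intro i hi
    rcases le_or_gt (p i).natDegree N with hle | hlt
    · intro j hj
      exact proj_apply_of_mem_of_ne 𝓐 (hc' i hi hle) (by omega)
    · rw [hc0 i hlt]
      exact zero_mem _
  refine ⟨c', hcG, fun j hj => ?_⟩
  rw [map_sub, map_sum, sub_eq_zero]
  rcases eq_or_ne j N with rfl | hne
  · rw [hsum]
    refine Finset.sum_congr rfl fun i hi => ?_
    have hi := Finset.mem_range.1 hi
    rcases le_or_gt (p i).natDegree j with hle | hlt
    · obtain ⟨r, rfl⟩ := Nat.exists_eq_add_of_le hle
      have hr : c' i ∈ 𝓐 r := by simpa using hc' i hi hle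
      rw [proj_add_mul_of_mem 𝓐 (hG i (hi.trans hs)) (by
        convert hcG i hi using 2; push_cast; omega),
        htop i (hi.trans hs), proj_apply_of_mem 𝓐 hr]
    · rw [hc0 i hlt, mul_zero, mul_zero, map_zero]
  · rw [hb j (by omega)]
    refine (Finset.sum_eq_zero fun i hi => ?_).symm
    have hi := Finset.mem_range.1 hi
    exact mul_mem_degreeFiltration 𝓐 _ _ _ _ (hG i (hi.trans hs)) (hcG i hi) j (by omega)

end GradedAlgebra

/-! ### Dimension bounds from linear forms -/

section Dimension

/-- Only incomparability is needed, so B → A need not be injective. -/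
theorem ringKrullDim_le_of_isIntegral {B A : Type*} [CommRing B] [CommRing A] [Algebra B A]
    [Algebra.IsIntegral B A] : ringKrullDim A ≤ ringKrullDim B := by
  refine Order.krullDim_le_of_strictMono
    (fun P : PrimeSpectrum A => PrimeSpectrum.comap (algebraMap B A) P) ?_
  intro P Q hPQ
  obtain ⟨hle, x, hxQ, hxP⟩ := SetLike.lt_iff_le_and_exists.1 (show P.asIdeal < Q.asIdeal from hPQ)
  exact Ideal.comap_lt_comap_of_integral_mem_sdiff (I := P.asIdeal) (J := Q.asIdeal) hle
    ⟨hxQ, hxP⟩ (Algebra.IsIntegral.isIntegral x)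

variable {k A : Type*} [Field k] [CommRing A] [Algebra k A] (𝓐 : ℕ → Submodule k A)
  [GradedAlgebra 𝓐]

theorem exists_mem_sub_one {u : ℕ → A} {g : ℕ} (hu : ∀ i < g, u i ∈ 𝓐 1) {n : ℕ} {a : A}
    (hn : 1 ≤ n) (ha : a ∈ 𝓐 n) (hmem : a ∈ Ideal.span (u '' Set.Iio g)) :
    ∃ c : ℕ → A, (∀ i < g, c i ∈ 𝓐 (n - 1)) ∧ a = ∑ i ∈ Finset.range g, u i * c i := by
  obtain ⟨c, hc, -, h⟩ := exists_proj_eq_sum 𝓐 (d := fun _ => 1) hu hmem n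
  exact ⟨c, fun i hi => hc i hi hn, by rw [← h, proj_apply_of_mem 𝓐 ha]⟩

/-- Linear forms are a regular sequence if the defining condition holds for homogeneous elements. -/
theorem regSeq_of_forall_homogeneous {u : ℕ → A} {g : ℕ} (hu : ∀ i < g, u i ∈ 𝓐 1)
    (h : ∀ s < g, ∀ n, ∀ a ∈ 𝓐 n, u s * a ∈ Ideal.span (u '' Set.Iio s) →
      a ∈ Ideal.span (u '' Set.Iio s)) : RegSeq u g := by
  intro s hs a ha
  refine mem_of_forall_proj_mem 𝓐 fun n => h s hs n _ (proj_mem 𝓐 n a) ?_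
  have := proj_mem_span 𝓐 (d := fun _ => 1) (fun i hi => hu i (hi.trans hs)) ha (n + 1)
  rwa [proj_mul_of_le 𝓐 (hu s hs) (by omega), Nat.add_sub_cancel] at this

/-- If `g` linear forms generate an ideal containing all forms of large degree, then the dimension is
at most `g`. -/
theorem ringKrullDim_le_of_forall_le_span
    (hfg : ∀ n, ∃ S : Finset A, ∀ a ∈ 𝓐 n, ∃ c : A → k, a = ∑ x ∈ S, algebraMap k A (c x) * x) {u : ℕ → A} {g N : ℕ}
    (hu : ∀ i < g, u i ∈ 𝓐 1)
    (hN : ∀ n ≥ N, ∀ a ∈ 𝓐 n, a ∈ Ideal.span (u '' Set.Iio g)) : ringKrullDim A ≤ g := by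
  let φ : MvPolynomial (Fin g) k →ₐ[k] A := MvPolynomial.aeval fun i : Fin g => u i
  let _ : Algebra (MvPolynomial (Fin g) k) A := φ.toRingHom.toAlgebra
  have : IsScalarTower k (MvPolynomial (Fin g) k) A :=
    IsScalarTower.of_algebraMap_eq fun r => (φ.commutes r).symm
  choose S hS using hfg
  let W : Submodule (MvPolynomial (Fin g) k) A :=
    -- Forms of degree above `N` reduce to lower degree through the `u i`, so degrees 0, …, `N`
    -- generate `A` over the polynomial ring. Degree 0 must be included even when `N = 0`.
    Submodule.span _ (⋃ n ∈ Finset.range (N + 1), (S n : Set A))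
  have hsmall : ∀ n < N + 1, ∀ a ∈ 𝓐 n, a ∈ W := by
    intro n hn a ha
    obtain ⟨c, rfl⟩ := hS n a ha
    refine sum_mem fun x hx => ?_
    rw [← Algebra.smul_def]
    exact W.smul_of_tower_mem _
      (Submodule.subset_span (Set.mem_biUnion (Finset.mem_range.2 hn) hx))
  have hall : ∀ n, ∀ a ∈ 𝓐 n, a ∈ W := by
    intro n
    induction n with
    | zero => exact hsmall 0 (Nat.succ_pos N)
    | succ n ih =>
      intro a ha
      rcases lt_or_ge n N with h | h
      · exact hsmall _ (by omega) a ha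
      obtain ⟨c, hc, rfl⟩ := exists_mem_sub_one 𝓐 hu (by omega) ha (hN _ (by omega) a ha)
      refine sum_mem fun i hi => ?_
      have hi := Finset.mem_range.1 hi
      have h1 := W.smul_mem (MvPolynomial.X ⟨i, hi⟩) (ih (c i) (hc i hi))
      rw [Algebra.smul_def] at h1
      have h2 : algebraMap (MvPolynomial (Fin g) k) A (MvPolynomial.X ⟨i, hi⟩) = u i :=
        MvPolynomial.aeval_X _ _
      rwa [h2] at h1
  have : Module.Finite (MvPolynomial (Fin g) k) A := by
    refine ⟨(Submodule.fg_def).2 ⟨⋃ n ∈ Finset.range (N + 1), (S n : Set A), ?_, ?_⟩⟩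
    · exact (Finset.finite_toSet _).biUnion fun n _ => (S n).finite_toSet
    · rw [eq_top_iff]
      intro a _
      obtain ⟨T, hT⟩ := exists_sum_proj 𝓐 a
      rw [hT]
      exact sum_mem fun n _ => hall n _ (proj_mem 𝓐 n a)
  refine (ringKrullDim_le_of_isIntegral (B := MvPolynomial (Fin g) k)).trans ?_
  rw [MvPolynomial.ringKrullDim_of_isNoetherianRing, ringKrullDim_eq_zero_of_field]
  simp

/-- If `g + 1` linear forms generate an ideal containing all forms of large degree in an algebra of
dimension greater than `g`, then the last one is not nilpotent modulo the others. -/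
theorem pow_notMem_span
    (hfg : ∀ n, ∃ S : Finset A, ∀ a ∈ 𝓐 n, ∃ c : A → k, a = ∑ x ∈ S, algebraMap k A (c x) * x) {u : ℕ → A} {g N : ℕ}
    (hu : ∀ i < g + 1, u i ∈ 𝓐 1)
    (hN : ∀ n ≥ N, ∀ a ∈ 𝓐 n, a ∈ Ideal.span (u '' Set.Iio (g + 1)))
    (hdim : (g : WithBot ℕ∞) < ringKrullDim A) (m : ℕ) :
    u g ^ m ∉ Ideal.span (u '' Set.Iio g) := by
  intro hm
  refine hdim.not_ge (ringKrullDim_le_of_forall_le_span 𝓐 hfg (N := N + m)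
    (fun i hi => hu i (hi.trans (Nat.lt_succ_self g))) fun n hn a ha => ?_)
  -- Each extra degree allows one more factor `u g` to be split off; at `j = m` that power is
  -- absorbed by the other forms, so `g` forms suffice in large degree.
  have main : ∀ j n, N + j ≤ n → ∀ a ∈ 𝓐 n,
      a ∈ Ideal.span (u '' Set.Iio g) ⊔ Ideal.span {u g ^ j} := by
    intro j
    induction j with
    | zero => simp
    | succ j ih =>
      intro n hn a ha
      obtain ⟨c, hc, rfl⟩ := exists_mem_sub_one 𝓐 hu (by omega) ha (hN _ (by omega) a ha)
      rw [Finset.sum_range_succ]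
      refine add_mem (Ideal.mem_sup_left (sum_mul_mem_span c)) ?_
      obtain ⟨x, hx, y, hy, hxy⟩ := Submodule.mem_sup.1 (ih (n - 1) (by omega) (c g)
        (hc g (Nat.lt_succ_self g)))
      obtain ⟨b, rfl⟩ := Ideal.mem_span_singleton'.1 hy
      rw [← hxy, mul_add]
      refine add_mem (Ideal.mem_sup_left (Ideal.mul_mem_left _ _ hx)) (Ideal.mem_sup_right ?_)
      exact Ideal.mem_span_singleton'.2 ⟨b, by ring⟩
  have := main m n hn a ha
  rwa [sup_eq_left.2 ((Ideal.span_singleton_le_iff_mem _).2 hm)] at this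

end Dimension

/-! ### The Cohen–Macaulay property of a graded algebra and its linear system of parameters -/

section CohenMacaulay

open IsLocalRing

theorem RegSeq.localization {A : Type*} [CommRing A] {u : ℕ → A} {n : ℕ} (h : RegSeq u n)
    (P : Ideal A) [P.IsPrime] :
    RegSeq (fun i => algebraMap A (Localization.AtPrime P) (u i)) n := by
  rw [← isWeaklyRegular_map_range_iff] at h ⊢
  have := h.of_isLocalization (Localization.AtPrime P) P.primeCompl
  simpa [Function.comp_def] using this

variable {k A : Type*} [Field k] [CommRing A] [Algebra k A] (𝓐 : ℕ → Submodule k A)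
  [GradedAlgebra 𝓐]

/-- A graded algebra of dimension `n` with a regular sequence of `n` linear forms is
Cohen–Macaulay. -/
theorem isCohenMacaulayRing_of_regSeq [Algebra.FiniteType k A] {u : ℕ → A} {n : ℕ}
    (hu : ∀ i < n, u i ∈ 𝓐 1) (h : RegSeq u n) (hdim : ringKrullDim A ≤ n) :
    IsCohenMacaulayRing A := by
  have hA : IsNoetherianRing A := Algebra.FiniteType.isNoetherianRing k A
  refine ⟨hA, fun P hP => ?_⟩
  have hL : IsNoetherianRing (Localization.AtPrime P) :=
    IsLocalization.isNoetherianRing P.primeCompl _ hA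
  refine ⟨hL, le_antisymm depth_le_ringKrullDim ?_⟩
  let _ : Field (A ⧸ P) := Ideal.Quotient.field P
  have hfin : Module.Finite k (A ⧸ P) := finite_of_finite_type_of_isJacobsonRing k (A ⧸ P)
  have hint : ∀ x : A ⧸ P, IsIntegral k x := fun x => Algebra.IsIntegral.isIntegral x
  -- `P` need not contain the `u i`. By the Nullstellensatz `A ⧸ P` is finite over `k`, so minimal
  -- polynomials of their residues exist and give elements of `P`.
  have hreg := (h.aeval_monic 𝓐 hu (p := fun i => minpoly k (Ideal.Quotient.mk P (u i)))
    fun i _ => minpoly.monic (hint _)).localization P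
  have hmem : ∀ i, aeval (u i) (minpoly k (Ideal.Quotient.mk P (u i))) ∈ P := by
    intro i
    rw [← Ideal.Quotient.eq_zero_iff_mem, ← Ideal.Quotient.mkₐ_eq_mk k, ← aeval_algHom_apply]
    exact minpoly.aeval _ _
  have hdepth := le_depth_of_regSeq (fun i _ =>
    (IsLocalization.AtPrime.to_map_mem_maximal_iff (Localization.AtPrime P) P _).2 (hmem i)) hreg
  rw [IsLocalization.AtPrime.ringKrullDim_eq_height P]
  refine le_trans (Ideal.height_le_ringKrullDim_of_ne_top hP.ne_top) (hdim.trans ?_)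
  exact_mod_cast hdepth

theorem isMaximal_irrelevant [Nontrivial A] (h0 : 𝓐 0 = 1) :
    (HomogeneousIdeal.irrelevant 𝓐).toIdeal.IsMaximal := by
  rw [Ideal.isMaximal_iff]
  have h1 : (1 : A) ∈ 𝓐 0 := SetLike.one_mem_graded 𝓐
  have hmem : ∀ x, x ∈ (HomogeneousIdeal.irrelevant 𝓐).toIdeal ↔
      GradedAlgebra.proj 𝓐 0 x = 0 := fun x => HomogeneousIdeal.mem_irrelevant_iff 𝓐 x
  refine ⟨?_, fun J x hJ hx hxJ => ?_⟩
  · rw [hmem, proj_apply_of_mem 𝓐 h1]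
    exact one_ne_zero
  · rw [hmem] at hx
    have hx0 := proj_mem 𝓐 0 x
    rw [h0, Submodule.mem_one] at hx0
    obtain ⟨c, hc⟩ := hx0
    have hc0 : c ≠ 0 := by
      rintro rfl
      exact hx (by rw [← hc, map_zero])
    have hsub : x - algebraMap k A c ∈ J := hJ (by
      rw [hmem, map_sub, hc, proj_apply_of_mem 𝓐 (proj_mem 𝓐 0 x), sub_self])
    have h2 : algebraMap k A c ∈ J := by simpa using sub_mem hxJ hsub
    have h3 := J.mul_mem_left (algebraMap k A c⁻¹) h2
    rwa [← map_mul, inv_mul_cancel₀ hc0, map_one] at h3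

/-- A homogeneous ideal contains `a` if it contains `t * a` for some `t` outside the irrelevant
ideal. -/
theorem mem_of_mul_mem_of_notMem_irrelevant (h0 : 𝓐 0 = 1) {u : ℕ → A} {g : ℕ}
    (hu : ∀ i < g, u i ∈ 𝓐 1) {t a : A} {n : ℕ} (ha : a ∈ 𝓐 n)
    (ht : t ∉ (HomogeneousIdeal.irrelevant 𝓐).toIdeal)
    (hta : t * a ∈ Ideal.span (u '' Set.Iio g)) : a ∈ Ideal.span (u '' Set.Iio g) := by
  have ht' : GradedAlgebra.proj 𝓐 0 t ≠ 0 :=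
    fun h => ht ((HomogeneousIdeal.mem_irrelevant_iff 𝓐 t).2 h)
  have h1 := proj_mem_span 𝓐 (d := fun _ => 1) hu hta n
  rw [mul_comm, proj_mul_of_le 𝓐 ha le_rfl, Nat.sub_self] at h1
  have hx0 := proj_mem 𝓐 0 t
  rw [h0, Submodule.mem_one] at hx0
  obtain ⟨c, hc⟩ := hx0
  have hc0 : c ≠ 0 := by
    rintro rfl
    exact ht' (by rw [← hc, map_zero])
  rw [← hc] at h1
  have h3 := Ideal.mul_mem_left _ (algebraMap k A c⁻¹) h1
  rwa [mul_left_comm, ← map_mul, inv_mul_cancel₀ hc0, map_one, mul_one] at h3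

theorem span_image_map {A B : Type*} [CommRing A] [CommRing B] (φ : A →+* B) (u : ℕ → A) (g : ℕ) :
    Ideal.span ((fun i => φ (u i)) '' Set.Iio g) = (Ideal.span (u '' Set.Iio g)).map φ := by
  rw [Ideal.map_span, Set.image_image]

/-- The localization at the irrelevant ideal has dimension greater than `g`. -/
theorem lt_ringKrullDim_localization [IsNoetherianRing A] (h0 : 𝓐 0 = 1)
    [hp : (HomogeneousIdeal.irrelevant 𝓐).toIdeal.IsPrime]
    {u : ℕ → A} {g : ℕ} (hu : ∀ i < g + 1, u i ∈ 𝓐 1) (hreg : RegSeq u g)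
    (hpow : ∀ m, u g ^ m ∉ Ideal.span (u '' Set.Iio g)) :
    (g : WithBot ℕ∞) <
      ringKrullDim (Localization.AtPrime (HomogeneousIdeal.irrelevant 𝓐).toIdeal) := by
  set p := (HomogeneousIdeal.irrelevant 𝓐).toIdeal with hpdef
  set L := Localization.AtPrime p
  have hu' : ∀ i < g, u i ∈ 𝓐 1 := fun i hi => hu i (hi.trans (Nat.lt_succ_self g))
  have hL : IsNoetherianRing L := IsLocalization.isNoetherianRing p.primeCompl _ inferInstance
  have hup : ∀ i < g + 1, u i ∈ p := fun i hi => by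
    rw [hpdef, HomogeneousIdeal.toIdeal, HomogeneousIdeal.mem_iff, HomogeneousIdeal.mem_irrelevant_iff]
    exact proj_apply_of_mem_of_ne 𝓐 (hu i hi) one_ne_zero
  have hum : ∀ i < g + 1, algebraMap A L (u i) ∈ maximalIdeal L := fun i hi =>
    (IsLocalization.AtPrime.to_map_mem_maximal_iff L p _).2 (hup i hi)
  have hregL := (isWeaklyRegular_map_range_iff _ _).2 (hreg.localization p)
  have hR := (IsLocalRing.isRegular_iff_isWeaklyRegular_of_subset_maximalIdeal (M := L) (by
    intro x hx
    obtain ⟨i, hi, rfl⟩ := List.mem_map.1 hx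
    exact hum i ((List.mem_range.1 hi).trans (Nat.lt_succ_self g)))).2 hregL
  rw [← ringKrullDim_add_length_eq_ringKrullDim_of_isRegular _ hR, ofList_map_range,
    List.length_map, List.length_range]
  set Q := Ideal.span ((fun i => algebraMap A L (u i)) '' Set.Iio g) with hQ
  have hQmem : ∀ m, algebraMap A L (u g) ^ m ∉ Q := by
    intro m hm
    rw [hQ, span_image_map, ← map_pow,
      IsLocalization.algebraMap_mem_map_algebraMap_iff p.primeCompl] at hm
    obtain ⟨t, ht, hta⟩ := hm
    refine hpow m (mem_of_mul_mem_of_notMem_irrelevant 𝓐 h0 hu' (n := m) ?_ ht hta)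
    simpa using SetLike.pow_mem_graded m (hu g (Nat.lt_succ_self g))
  have hQtop : Q ≠ ⊤ := fun h => hQmem 0 (h ▸ trivial)
  have : Nontrivial (L ⧸ Q) := Ideal.Quotient.nontrivial_iff.2 hQtop
  -- In dimension zero, `u g` would be nilpotent modulo `Q`. Membership of a form descends from `L`
  -- to `A`, which would contradict `hpow`.
  have hpos : (0 : WithBot ℕ∞) < ringKrullDim (L ⧸ Q) := by
    refine lt_of_le_of_ne ringKrullDim_nonneg_of_nontrivial fun hzero => ?_
    have h0 : Ring.KrullDimLE 0 (L ⧸ Q) := (Ring.krullDimLE_iff).2 (by simpa using hzero.symm.le)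
    have : IsLocalRing (L ⧸ Q) := .of_surjective' (Ideal.Quotient.mk Q) Ideal.Quotient.mk_surjective
    have hnil : IsNilpotent (Ideal.Quotient.mk Q (algebraMap A L (u g))) := by
      have htfae := (Ring.krullDimLE_zero_and_isLocalRing_tfae (L ⧸ Q)).out 0 2
      refine (htfae.1 ⟨h0, this⟩ _).2 ?_
      intro hunit
      obtain ⟨y, hy⟩ := hunit.exists_right_inv
      obtain ⟨y, rfl⟩ := Ideal.Quotient.mk_surjective y
      rw [← map_mul, ← map_one (Ideal.Quotient.mk Q), Ideal.Quotient.eq] at hy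
      refine (maximalIdeal.isMaximal L).ne_top ((Ideal.eq_top_iff_one _).2 ?_)
      have := sub_mem ((maximalIdeal L).mul_mem_right y (hum g (Nat.lt_succ_self g)))
        (le_maximalIdeal hQtop hy)
      rwa [sub_sub_cancel] at this
    obtain ⟨m, hm⟩ := hnil
    rw [← map_pow, Ideal.Quotient.eq_zero_iff_mem] at hm
    exact hQmem m hm
  obtain ⟨q, hq⟩ : ∃ q : ℕ∞, ringKrullDim (L ⧸ Q) = q := by
    cases h : ringKrullDim (L ⧸ Q) with
    | bot => simp [h] at hpos
    | coe q => exact ⟨q, rfl⟩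
  rw [hq] at hpos ⊢
  have hq1 : 1 ≤ q := Order.one_le_iff_pos.2 (by exact_mod_cast hpos)
  norm_cast
  calc (g : ℕ∞) < ((g + 1 : ℕ) : ℕ∞) := Nat.cast_lt.2 (Nat.lt_succ_self g)
    _ ≤ q + g := by
      rw [Nat.cast_add, add_comm]
      gcongr
      exact_mod_cast hq1

/-- If multiplication by the last form is not injective modulo the others, then the ideal of
the others has a socle element. -/
theorem exists_socle {u : ℕ → A} {g N n : ℕ}
    (hN : ∀ n ≥ N, ∀ a ∈ 𝓐 n, a ∈ Ideal.span (u '' Set.Iio (g + 1)))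
    {a : A} (ha : a ∈ 𝓐 n) (hua : u g * a ∈ Ideal.span (u '' Set.Iio g))
    (han : a ∉ Ideal.span (u '' Set.Iio g)) :
    ∃ m, ∃ z ∈ 𝓐 m, z ∉ Ideal.span (u '' Set.Iio g) ∧
      ∀ y ∈ (HomogeneousIdeal.irrelevant 𝓐).toIdeal, y * z ∈ Ideal.span (u '' Set.Iio g) := by
  classical
  set Q := Ideal.span (u '' Set.Iio g) with hQ
  -- All of `u 0, …, u g` kill `a` modulo `Q`, hence so do all forms of large degree. Just below the
  -- least threshold there is a form `x` with `x * a ∉ Q`, and `x * a` is the socle element.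
  have hbig : ∀ m ≥ N, ∀ x ∈ 𝓐 m, x * a ∈ Q := by
    intro m hm x hx
    have := hN m hm x hx
    rw [span_image_Iio_succ, Submodule.mem_sup] at this
    obtain ⟨v, hv, w, hw, rfl⟩ := this
    obtain ⟨b, rfl⟩ := Ideal.mem_span_singleton'.1 hw
    rw [add_mul, mul_assoc]
    exact add_mem (Ideal.mul_mem_right _ _ hv) (Ideal.mul_mem_left _ _ hua)
  have hex : ∃ j, ∀ m ≥ j, ∀ x ∈ 𝓐 m, x * a ∈ Q := ⟨N, hbig⟩
  have hspec := Nat.find_spec hex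
  have hne : Nat.find hex ≠ 0 := by
    intro h0
    rw [h0] at hspec
    exact han (by simpa using hspec 0 le_rfl 1 (SetLike.one_mem_graded 𝓐))
  obtain ⟨j, hj⟩ := Nat.exists_eq_succ_of_ne_zero hne
  have hmin := Nat.find_min hex (m := j) (by omega)
  push Not at hmin
  obtain ⟨m, hm, x, hx, hxa⟩ := hmin
  have hmj : m = j := by
    by_contra hne
    exact hxa (hspec m (by omega) x hx)
  subst hmj
  refine ⟨m + n, x * a, SetLike.mul_mem_graded hx ha, hxa, fun y hy => ?_⟩
  have hy0 : GradedAlgebra.proj 𝓐 0 y = 0 := (HomogeneousIdeal.mem_irrelevant_iff 𝓐 y).1 hy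
  obtain ⟨S, hS⟩ := exists_sum_proj 𝓐 y
  rw [hS, Finset.sum_mul]
  refine sum_mem fun i _ => ?_
  rcases Nat.eq_zero_or_pos i with rfl | hi
  · rw [hy0, zero_mul]
    exact zero_mem _
  · rw [← mul_assoc]
    exact hspec (i + m) (by omega) _ (SetLike.mul_mem_graded (proj_mem 𝓐 i y) hx)

/-- A failure produces a socle element modulo a regular sequence of length g. It survives
localization at the irrelevant ideal, so the depth there is at most g, below the dimension. -/
theorem regSeq_succ_of_isCohenMacaulayRing [Nontrivial A] (h0 : 𝓐 0 = 1) {u : ℕ → A} {g N : ℕ}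
    (hu : ∀ i < g + 1, u i ∈ 𝓐 1) (hreg : RegSeq u g)
    (hN : ∀ n ≥ N, ∀ a ∈ 𝓐 n, a ∈ Ideal.span (u '' Set.Iio (g + 1)))
    (hpow : ∀ m, u g ^ m ∉ Ideal.span (u '' Set.Iio g)) (hCM : IsCohenMacaulayRing A)
    {n : ℕ} {a : A} (ha : a ∈ 𝓐 n) (hua : u g * a ∈ Ideal.span (u '' Set.Iio g)) :
    a ∈ Ideal.span (u '' Set.Iio g) := by
  by_contra han
  obtain ⟨hA, hCM⟩ := hCM
  obtain ⟨m, z, hz, hzn, hzm⟩ := exists_socle 𝓐 hN ha hua han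
  have hmax := isMaximal_irrelevant 𝓐 h0
  have hlt := lt_ringKrullDim_localization 𝓐 h0 hu hreg hpow
  obtain ⟨hL, hdepth⟩ := hCM (HomogeneousIdeal.irrelevant 𝓐).toIdeal
  have hu' : ∀ i < g, u i ∈ 𝓐 1 := fun i hi => hu i (hi.trans (Nat.lt_succ_self g))
  set p := (HomogeneousIdeal.irrelevant 𝓐).toIdeal with hpdef
  rw [← hdepth] at hlt
  refine hlt.not_ge ?_
  have := depth_le_of_hasSocle (L := Localization.AtPrime p) (r := g)
    (u := fun i => algebraMap A _ (u i)) (fun i hi => by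
      refine (IsLocalization.AtPrime.to_map_mem_maximal_iff _ p _).2 ?_
      exact (HomogeneousIdeal.mem_irrelevant_iff 𝓐 _).2
        (proj_apply_of_mem_of_ne 𝓐 (hu' i hi) one_ne_zero)) (hreg.localization p)
    ⟨algebraMap A _ z, ?_, ?_⟩
  · exact_mod_cast this
  · rw [span_image_map, IsLocalization.algebraMap_mem_map_algebraMap_iff p.primeCompl]
    rintro ⟨t, ht, hta⟩
    exact hzn (mem_of_mul_mem_of_notMem_irrelevant 𝓐 h0 hu' hz ht hta)
  · intro x hx
    rw [← Localization.AtPrime.map_eq_maximalIdeal] at hx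
    rw [span_image_map]
    have hle : p ≤ (((Ideal.span (u '' Set.Iio g)).map
        (algebraMap A (Localization.AtPrime p))).colon
          {algebraMap A (Localization.AtPrime p) z}).comap
            (algebraMap A (Localization.AtPrime p)) := by
      intro y hy
      rw [Ideal.mem_comap, Submodule.mem_colon_singleton, smul_eq_mul, ← map_mul]
      exact Ideal.mem_map_of_mem _ (hzm y hy)
    simpa [Submodule.mem_colon_singleton] using Ideal.map_le_iff_le_comap.2 hle hx

/-- Cohen–Macaulayness of a graded algebra of dimension `g + 1` in terms of a linear system of
parameters whose first `g` members form a regular sequence. -/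
theorem isCohenMacaulayRing_iff_of_regSeq [Nontrivial A] [Algebra.FiniteType k A] (h0 : 𝓐 0 = 1)
    (hfg : ∀ n, ∃ S : Finset A, ∀ a ∈ 𝓐 n, ∃ c : A → k, a = ∑ x ∈ S, algebraMap k A (c x) * x)
    {u : ℕ → A} {g N : ℕ} (hu : ∀ i < g + 1, u i ∈ 𝓐 1)
    (hreg : RegSeq u g) (hN : ∀ n ≥ N, ∀ a ∈ 𝓐 n, a ∈ Ideal.span (u '' Set.Iio (g + 1)))
    (hdim : ringKrullDim A = g + 1) :
    (∀ n ≥ 1, ∀ a ∈ 𝓐 n, u g * a ∈ Ideal.span (u '' Set.Iio g) →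
      a ∈ Ideal.span (u '' Set.Iio g)) ↔ IsCohenMacaulayRing A := by
  have hpow := pow_notMem_span 𝓐 hfg hu hN (by rw [hdim]; norm_cast; simp)
  have hu' : ∀ i < g, u i ∈ 𝓐 1 := fun i hi => hu i (hi.trans (Nat.lt_succ_self g))
  constructor
  · intro h
    have h' : ∀ n, ∀ a ∈ 𝓐 n, u g * a ∈ Ideal.span (u '' Set.Iio g) →
        a ∈ Ideal.span (u '' Set.Iio g) := by
      intro n
      -- Tightness says nothing about n = 0. There a nonzero `a` is a unit scalar, and `u g` would
      -- lie in the ideal of the others, against `hpow 1`.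
      rcases Nat.eq_zero_or_pos n with rfl | hn
      · intro a ha hua
        by_cases hir : a ∈ (HomogeneousIdeal.irrelevant 𝓐).toIdeal
        · have : GradedAlgebra.proj 𝓐 0 a = 0 := (HomogeneousIdeal.mem_irrelevant_iff 𝓐 a).1 hir
          rw [proj_apply_of_mem 𝓐 ha] at this
          rw [this]
          exact zero_mem _
        · rw [mul_comm] at hua
          have := mem_of_mul_mem_of_notMem_irrelevant 𝓐 h0 hu' (hu g (Nat.lt_succ_self g)) hir hua
          exact absurd (by simpa using this) (hpow 1)
      · exact h n hn
    refine isCohenMacaulayRing_of_regSeq 𝓐 hu (n := g + 1)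
      (regSeq_of_forall_homogeneous 𝓐 hu fun s hs => ?_) (by rw [hdim]; simp)
    rcases Nat.lt_succ_iff_lt_or_eq.1 hs with hs | rfl
    · exact fun _ a _ => hreg s hs a
    · exact h'
  · intro hCM n _ a ha hua
    exact regSeq_succ_of_isCohenMacaulayRing 𝓐 h0 hu hreg hN hpow hCM ha hua

end CohenMacaulay

/-! ### Finiteness of standard graded algebras -/

section StandardGraded

variable {k R : Type*} [Field k] [CommRing R] [Algebra k R] {𝒜 : ℕ → Submodule k R}
  [GradedAlgebra 𝒜]

theorem IsStandardGraded.finiteType (hR : IsStandardGraded 𝒜) : Algebra.FiniteType k R := by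
  have := hR.finite_degree_one
  obtain ⟨S, hS⟩ := (Submodule.fg_iff_finiteDimensional (𝒜 1)).2 this
  refine ⟨⟨S, ?_⟩⟩
  rw [← hR.adjoin_degree_one, ← hS, Algebra.adjoin_span]

theorem IsStandardGraded.proj_mem_pow (hR : IsStandardGraded 𝒜) (x : R) (n : ℕ) :
    GradedAlgebra.proj 𝒜 n x ∈ 𝒜 1 ^ n := by
  have hx : x ∈ Algebra.adjoin k (𝒜 1 : Set R) := hR.adjoin_degree_one ▸ Algebra.mem_top
  induction hx using Algebra.adjoin_induction generalizing n with
  | mem x hx =>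
    rcases eq_or_ne 1 n with rfl | hne
    · rw [proj_apply_of_mem 𝒜 hx, pow_one]
      exact hx
    · rw [proj_apply_of_mem_of_ne 𝒜 hx hne]
      exact zero_mem _
  | algebraMap r =>
    have hr : algebraMap k R r ∈ 𝒜 0 := SetLike.algebraMap_mem_graded 𝒜 r
    rcases eq_or_ne 0 n with rfl | hne
    · rw [proj_apply_of_mem 𝒜 hr, pow_zero]
      exact Submodule.algebraMap_mem r
    · rw [proj_apply_of_mem_of_ne 𝒜 hr hne]
      exact zero_mem _
  | add x y _ _ hx hy =>
    rw [map_add]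
    exact add_mem (hx n) (hy n)
  | mul x y _ _ hx hy =>
    obtain ⟨S, hS⟩ := exists_sum_proj 𝒜 x
    rw [hS, Finset.sum_mul, map_sum]
    refine sum_mem fun i _ => ?_
    rcases le_or_gt i n with hi | hi
    · rw [proj_mul_of_le 𝒜 (proj_mem 𝒜 i x) hi, ← Nat.add_sub_cancel' hi, pow_add,
        Nat.add_sub_cancel_left]
      exact Submodule.mul_mem_mul (hx i) (hy _)
    · rw [proj_mul_of_lt 𝒜 (proj_mem 𝒜 i x) hi]
      exact zero_mem _

theorem IsStandardGraded.fg (hR : IsStandardGraded 𝒜) (n : ℕ) : (𝒜 n).FG := by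
  have := hR.finite_degree_one
  have h1 : (𝒜 1 ^ n).FG := ((Submodule.fg_iff_finiteDimensional (𝒜 1)).2 this).pow n
  refine h1.of_le fun x hx => ?_
  rw [← proj_apply_of_mem 𝒜 hx]
  exact hR.proj_mem_pow x n

end StandardGraded

/-! ### Rees algebra and associated graded ring in terms of coefficients -/

section Rees

variable {R : Type*} [CommRing R] {I : Ideal R}

/-- The element `a tⁿ` of the Rees algebra. -/
noncomputable def reesMonomial (n : ℕ) (a : R) (ha : a ∈ I ^ n) : reesAlgebra I :=
  ⟨monomial n a, reesAlgebra.monomial_mem.2 ha⟩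

theorem coe_reesMonomial {n : ℕ} {a : R} (ha : a ∈ I ^ n) :
    (reesMonomial n a ha : R[X]) = monomial n a := rfl

theorem reesMonomial_mul {m n : ℕ} {a b : R} (ha : a ∈ I ^ m) (hb : b ∈ I ^ n) :
    reesMonomial m a ha * reesMonomial n b hb =
      reesMonomial (m + n) (a * b) (pow_add I m n ▸ Ideal.mul_mem_mul ha hb) :=
  Subtype.ext (monomial_mul_monomial _ _ _ _)

theorem eq_sum_reesMonomial (p : reesAlgebra I) :
    p = ∑ n ∈ (p : R[X]).support, reesMonomial n ((p : R[X]).coeff n) (p.2 n) := by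
  refine Subtype.ext ?_
  rw [AddSubmonoidClass.coe_finsetSum]
  exact (p : R[X]).as_sum_support

/-- Used twice: with 𝔞 = I for the associated graded ring, and with 𝔞 the irrelevant ideal for the
special fiber. -/
theorem coeff_mem_of_mem_map {𝔞 : Ideal R} {p : reesAlgebra I}
    (hp : p ∈ 𝔞.map (algebraMap R (reesAlgebra I))) (n : ℕ) :
    (p : R[X]).coeff n ∈ 𝔞 * I ^ n := by
  induction hp using Submodule.span_induction generalizing n with
  | mem x hx =>
    obtain ⟨a, ha, rfl⟩ := hx
    change (C a).coeff n ∈ _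
    rw [coeff_C]
    split_ifs with h
    · subst h
      simpa using ha
    · exact zero_mem _
  | zero => simp
  | add x y _ _ hx hy => simpa using add_mem (hx n) (hy n)
  | smul q x _ hx =>
    rw [smul_eq_mul, MulMemClass.coe_mul, coeff_mul]
    refine sum_mem fun ij hij => ?_
    rw [← Finset.HasAntidiagonal.mem_antidiagonal.1 hij, pow_add, mul_left_comm]
    exact Ideal.mul_mem_mul (q.2 _) (hx _)

theorem reesMonomial_mem_map {𝔞 : Ideal R} {n : ℕ} {a : R} (ha : a ∈ 𝔞 * I ^ n) (h : a ∈ I ^ n) :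
    reesMonomial n a h ∈ 𝔞.map (algebraMap R (reesAlgebra I)) := by
  have hle : 𝔞 * I ^ n ≤ I ^ n := Ideal.mul_le_right
  induction ha using Submodule.mul_induction_on' with
  | mem_mul_mem x hx y hy =>
    have : reesMonomial n (x * y) h = algebraMap R (reesAlgebra I) x * reesMonomial n y hy :=
      Subtype.ext (C_mul_monomial ..).symm
    rw [this]
    exact Ideal.mul_mem_right _ _ (Ideal.mem_map_of_mem _ hx)
  | add x hx y hy hx' hy' =>
    have : reesMonomial n (x + y) h = reesMonomial n x (hle hx) + reesMonomial n y (hle hy) :=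
      Subtype.ext (map_add _ _ _)
    rw [this]
    exact add_mem (hx' _) (hy' _)

/-- Regularity in the associated graded ring, in terms of powers of the ideal. -/
theorem exists_of_regSeq_grImage {f : ℕ → R} (hf : ∀ i, f i ∈ I) {g : ℕ}
    (h : RegSeq (fun i => grImage I ⟨f i, hf i⟩) g) {s : ℕ} (hs : s < g) {n : ℕ} {b : R}
    (hb : b ∈ I ^ n)
    (hfb : ∃ c : ℕ → R, (∀ i < s, c i ∈ I ^ n) ∧
      f s * b - ∑ i ∈ Finset.range s, f i * c i ∈ I ^ (n + 2)) :
    ∃ c : ℕ → R, (∀ i < s, c i ∈ I ^ (n - 1)) ∧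
      b - ∑ i ∈ Finset.range s, f i * c i ∈ I ^ (n + 1) := by
  have hf1 : ∀ i, f i ∈ I ^ 1 := fun i => (pow_one I).symm ▸ hf i
  have hu : (fun i => grImage I ⟨f i, hf i⟩) =
    fun i => Ideal.Quotient.mk _ (reesMonomial 1 (f i) (hf1 i)) := rfl
  rw [hu] at h
  obtain ⟨c, hc, hcb⟩ := hfb
  have hmem := h s hs (Ideal.Quotient.mk _ (reesMonomial n b hb)) (by
    choose! c' hc' using fun i (hi : i < s) => (⟨reesMonomial n (c i) (hc i hi), rfl⟩ :
      ∃ q : reesAlgebra I, (q : R[X]) = monomial n (c i))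
    have heq : reesMonomial 1 (f s) (hf1 s) * reesMonomial n b hb -
        ∑ i ∈ Finset.range s, reesMonomial 1 (f i) (hf1 i) * c' i =
          reesMonomial (n + 1) (f s * b - ∑ i ∈ Finset.range s, f i * c i)
            (Ideal.pow_le_pow_right (by omega) hcb) := by
      refine Subtype.ext ?_
      rw [AddSubgroupClass.coe_sub, AddSubmonoidClass.coe_finsetSum, MulMemClass.coe_mul]
      rw [Finset.sum_congr rfl fun i hi => by
        rw [MulMemClass.coe_mul, hc' i (Finset.mem_range.1 hi)]]
      simp [reesMonomial, monomial_mul_monomial, add_comm]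
    have h0 : Ideal.Quotient.mk (I.map (algebraMap R (reesAlgebra I)))
        (reesMonomial 1 (f s) (hf1 s) * reesMonomial n b hb -
          ∑ i ∈ Finset.range s, reesMonomial 1 (f i) (hf1 i) * c' i) = 0 := by
      rw [Ideal.Quotient.eq_zero_iff_mem, heq]
      exact reesMonomial_mem_map (by rwa [← pow_succ']) _
    rw [map_sub, sub_eq_zero, map_mul, map_sum] at h0
    rw [h0]
    simp only [map_mul]
    exact sum_mul_mem_span (u := fun i => Ideal.Quotient.mk (I.map (algebraMap R (reesAlgebra I)))
      (reesMonomial 1 (f i) (hf1 i))) fun i => Ideal.Quotient.mk _ (c' i))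
  obtain ⟨q, hq⟩ := mem_span_image_Iio_iff.1 hmem
  choose p hp using fun i => Ideal.Quotient.mk_surjective (q i)
  have h1 : reesMonomial n b hb - ∑ i ∈ Finset.range s, reesMonomial 1 (f i) (hf1 i) * p i ∈
      I.map (algebraMap R (reesAlgebra I)) := by
    rw [← Ideal.Quotient.eq, hq, map_sum]
    simp only [map_mul, hp]
  have h2 := coeff_mem_of_mem_map h1 n
  rw [← pow_succ', AddSubgroupClass.coe_sub, AddSubmonoidClass.coe_finsetSum, coeff_sub,
    finsetSum_coeff] at h2
  simp only [MulMemClass.coe_mul, reesMonomial, coeff_monomial_same] at h2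
  cases n with
  | zero =>
    -- In degree 0 the products with the fᵢt contribute nothing, so zero coefficients work; `n - 1`
    -- is truncated here.
    refine ⟨0, fun i _ => zero_mem _, ?_⟩
    simpa [coeff_zero_eq_eval_zero] using h2
  | succ n =>
    refine ⟨fun i => (p i : R[X]).coeff n, fun i _ => (p i).2 n, ?_⟩
    simpa only [coeff_monomial_mul] using h2

end Rees

/-! ### The Valabrega–Valla property -/

section ValabregaValla

variable {R : Type*} [CommRing R] {I : Ideal R}

/-- Valabrega–Valla: if the initial forms of elements of `I` are a regular sequence in the associated
graded ring, then they generate the initial ideal of the ideal generated by these elements. -/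
theorem exists_of_mem_span_of_mem_pow {f : ℕ → R} (hf : ∀ i, f i ∈ I) {g : ℕ}
    (h : RegSeq (fun i => grImage I ⟨f i, hf i⟩) g) {s : ℕ} (hs : s ≤ g) {N : ℕ} {y : R}
    (hy : y ∈ I ^ N) (hmem : y ∈ Ideal.span (f '' Set.Iio s)) :
    ∃ c : ℕ → R, (∀ i < s, c i ∈ I ^ (N - 1)) ∧
      y - ∑ i ∈ Finset.range s, f i * c i ∈ I ^ (N + 1) := by
  -- The I-adic filtration, equal to R in negative degrees. It need not be separated: one step of
  -- approximation, modulo `I ^ (N + 1)`, is all that is used later.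
  let G : ℤ → AddSubgroup R := fun m => (I ^ m.toNat).toAddSubgroup
  have hG : ∀ m x, x ∈ G m ↔ x ∈ I ^ m.toNat := fun m x => Iff.rfl
  have key : InitMem G f (fun _ => 1) s (N : ℤ) y := by
    refine initMem_of_mem_span (G := G) (n := g) ?_ ?_ ?_ ?_ ?_ hs ?_ hmem
    · exact fun m n hmn x hx => Ideal.pow_le_pow_right (Int.toNat_le_toNat hmn) hx
    · intro m n x y hx hy
      rw [hG] at *
      refine Ideal.pow_le_pow_right (n := m.toNat + n.toNat) (by omega) ?_
      rw [pow_add]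
      exact Ideal.mul_mem_mul hx hy
    · exact fun x => ⟨0, by simp [hG]⟩
    · exact fun i _ => by simpa [hG] using hf i
    · intro t ht M b hb
      rintro ⟨c, hc, hcb⟩
      rcases lt_or_ge M 0 with hM | hM
      · exact ⟨0, fun _ _ => zero_mem _, by
          rw [hG, show (M + 1).toNat = 0 by omega, pow_zero, Ideal.one_eq_top]
          trivial⟩
      obtain ⟨n, rfl⟩ := Int.eq_ofNat_of_zero_le hM
      obtain ⟨c', hc', hcb'⟩ := exists_of_regSeq_grImage hf h ht (n := n) (b := b) hb
        ⟨c, fun i hi => by simpa [hG] using hc i hi, hcb⟩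
      refine ⟨c', fun i hi => ?_, hcb'⟩
      rw [hG]
      convert hc' i hi using 2
      dsimp only
      omega
    · exact hy
  obtain ⟨c, hc, hcb⟩ := key
  refine ⟨c, fun i hi => ?_, hcb⟩
  have := hc i hi
  rw [hG] at this
  convert this using 2
  dsimp only
  omega

theorem exists_of_mem_span_mul {f : ℕ → R} {s : ℕ} {K : Ideal R} {a : R}
    (ha : a ∈ Ideal.span (f '' Set.Iio s) * K) :
    ∃ c : ℕ → R, (∀ i, c i ∈ K) ∧ a = ∑ i ∈ Finset.range s, f i * c i := by
  induction ha using Submodule.mul_induction_on' with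
  | mem_mul_mem x hx y hy =>
    obtain ⟨c, rfl⟩ := mem_span_image_Iio_iff.1 hx
    refine ⟨fun i => c i * y, fun i => K.mul_mem_left _ hy, ?_⟩
    rw [Finset.sum_mul]
    exact Finset.sum_congr rfl fun i _ => mul_assoc _ _ _
  | add x _ y _ hx hy =>
    obtain ⟨c, hc, rfl⟩ := hx
    obtain ⟨c', hc', rfl⟩ := hy
    refine ⟨fun i => c i + c' i, fun i => add_mem (hc i) (hc' i), ?_⟩
    rw [← Finset.sum_add_distrib]
    exact Finset.sum_congr rfl fun i _ => (mul_add _ _ _).symm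

end ValabregaValla

/-! ### Degrees in an equigenerated ideal -/

section Equigenerated

variable {k R : Type*} [Field k] [CommRing R] [Algebra k R] {𝒜 : ℕ → Submodule k R}
  [GradedAlgebra 𝒜] {I : Ideal R} {d : ℕ}

open scoped Pointwise in
theorem IsEquigenerated.pow (h : IsEquigenerated 𝒜 I d) (n : ℕ) :
    IsEquigenerated 𝒜 (I ^ n) (n * d) := by
  obtain ⟨S, hS, rfl⟩ := h
  refine ⟨S ^ n, ?_, Submodule.span_pow S n⟩
  induction n with
  | zero =>
    rw [pow_zero, Nat.zero_mul]
    exact Set.one_subset.2 (SetLike.one_mem_graded 𝒜)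
  | succ n ih =>
    rw [pow_succ, Nat.succ_mul]
    rintro _ ⟨x, hx, y, hy, rfl⟩
    exact SetLike.mul_mem_graded (ih hx) (hS hy)

theorem IsEquigenerated.proj_eq_zero (h : IsEquigenerated 𝒜 I d) {x : R} (hx : x ∈ I) {m : ℕ}
    (hm : m < d) : GradedAlgebra.proj 𝒜 m x = 0 := by
  obtain ⟨S, hS, rfl⟩ := h
  obtain ⟨n, r, t, rfl⟩ := Submodule.mem_span_set'.1 hx
  rw [map_sum]
  refine Finset.sum_eq_zero fun i _ => ?_
  rw [smul_eq_mul, mul_comm]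
  exact proj_mul_of_lt 𝒜 (hS (t i).2) hm _

theorem IsEquigenerated.proj_mem (h : IsEquigenerated 𝒜 I d) {x : R} (hx : x ∈ I) :
    GradedAlgebra.proj 𝒜 d x ∈ I := by
  obtain ⟨S, hS, rfl⟩ := h
  obtain ⟨n, r, t, rfl⟩ := Submodule.mem_span_set'.1 hx
  rw [map_sum]
  refine sum_mem fun i _ => ?_
  rw [smul_eq_mul, mul_comm, proj_mul_of_le 𝒜 (hS (t i).2) le_rfl]
  exact Ideal.mul_mem_right _ _ (Ideal.subset_span (t i).2)

/-- Together with `IsEquigenerated.proj_eq_zero_of_mem_irrelevant_mul`, this identifies I/𝔪I with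
[I]_d. Both are applied to Iⁿ and nd to grade the special fiber. -/
theorem IsEquigenerated.sub_proj_mem (h : IsEquigenerated 𝒜 I d) {x : R} (hx : x ∈ I) :
    x - GradedAlgebra.proj 𝒜 d x ∈ (HomogeneousIdeal.irrelevant 𝒜).toIdeal * I := by
  obtain ⟨S, hS, rfl⟩ := h
  obtain ⟨n, r, t, rfl⟩ := Submodule.mem_span_set'.1 hx
  rw [map_sum, ← Finset.sum_sub_distrib]
  refine sum_mem fun i _ => ?_
  rw [smul_eq_mul, mul_comm (r i), proj_mul_of_le 𝒜 (hS (t i).2) le_rfl, Nat.sub_self, ← mul_sub,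
    mul_comm (t i : R)]
  refine Ideal.mul_mem_mul ((HomogeneousIdeal.mem_irrelevant_iff 𝒜 _).2 ?_)
    (Ideal.subset_span (t i).2)
  change GradedAlgebra.proj 𝒜 0 _ = 0
  rw [map_sub, proj_apply_of_mem 𝒜 (FiberCone.proj_mem 𝒜 0 (r i)), sub_self]

theorem IsEquigenerated.proj_eq_zero_of_mem_irrelevant_mul (h : IsEquigenerated 𝒜 I d) {x : R}
    (hx : x ∈ (HomogeneousIdeal.irrelevant 𝒜).toIdeal * I) : GradedAlgebra.proj 𝒜 d x = 0 := by
  induction hx using Submodule.mul_induction_on' with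
  | mem_mul_mem x hx y hy =>
    have hx0 : GradedAlgebra.proj 𝒜 0 x = 0 := (HomogeneousIdeal.mem_irrelevant_iff 𝒜 x).1 hx
    obtain ⟨S, hS⟩ := exists_sum_proj 𝒜 x
    rw [hS, Finset.sum_mul, map_sum]
    refine Finset.sum_eq_zero fun i _ => ?_
    rcases Nat.eq_zero_or_pos i with rfl | hi
    · rw [hx0, zero_mul, map_zero]
    · rcases le_or_gt i d with hid | hid
      · rw [proj_mul_of_le 𝒜 (FiberCone.proj_mem 𝒜 i x) hid, h.proj_eq_zero hy (by omega), mul_zero]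
      · exact proj_mul_of_lt 𝒜 (FiberCone.proj_mem 𝒜 i x) hid _
  | add x _ y _ hx hy => rw [map_add, hx, hy, add_zero]

end Equigenerated

/-! ### The grading of the special fiber by the spaces [Iⁿ]_{nd} -/

section Internal

theorem mem_degreePart {k R : Type*} [Field k] [CommRing R] [Algebra k R] (𝒜 : ℕ → Submodule k R)
    {J : Ideal R} {n : ℕ} {a : R} :
    a ∈ degreePart 𝒜 J n ↔ a ∈ J ∧ a ∈ 𝒜 n := Iff.rfl

theorem isInternal_of_forall_sum {k B : Type*} [Field k] [AddCommGroup B] [Module k B]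
    {𝓑 : ℕ → Submodule k B}
    (h : ∀ (S : Finset ℕ) (v : ℕ → B), (∀ n, v n ∈ 𝓑 n) → ∑ n ∈ S, v n = 0 → ∀ n ∈ S, v n = 0)
    (h' : ∀ x, ∃ (S : Finset ℕ) (v : ℕ → B), (∀ n, v n ∈ 𝓑 n) ∧ x = ∑ n ∈ S, v n) :
    DirectSum.IsInternal 𝓑 := by
  classical
  constructor
  · rw [injective_iff_map_eq_zero]
    intro v hv
    rw [DirectSum.coeAddMonoidHom_eq_dfinsuppSum, DFinsupp.sum] at hv
    refine DFinsupp.ext fun n => ?_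
    by_cases hn : n ∈ DFinsupp.support v
    · exact Subtype.ext (h _ (fun n => (v n : B)) (fun n => (v n).2) hv n hn)
    · exact DFinsupp.notMem_support_iff.1 hn
  · intro x
    obtain ⟨S, v, hv, rfl⟩ := h' x
    refine ⟨∑ n ∈ S, DirectSum.of (fun i => 𝓑 i) n ⟨v n, hv n⟩, ?_⟩
    rw [map_sum]
    exact Finset.sum_congr rfl fun n _ => DirectSum.coeAddMonoidHom_of _ _ _

end Internal

section SpecialFiber

variable {k R : Type*} [Field k] [CommRing R] [Algebra k R] (𝒜 : ℕ → Submodule k R)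
  [GradedAlgebra 𝒜] (I : Ideal R) (d : ℕ)

/-- The class of `a tⁿ` in the special fiber, for `a ∈ [Iⁿ]_{nd}`. -/
noncomputable def fiberClass (n : ℕ) :
    degreePart 𝒜 (I ^ n) (n * d) →ₗ[k] SpecialFiber 𝒜 I where
  toFun a := Ideal.Quotient.mk _ (reesMonomial n a.1 ((mem_degreePart 𝒜).1 a.2).1)
  map_add' a b := by
    rw [← map_add]
    exact congrArg _ (Subtype.ext (map_add _ _ _))
  map_smul' c a := by
    rw [RingHom.id_apply, ← Ideal.Quotient.mkₐ_eq_mk k, ← map_smul]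
    exact congrArg _ (Subtype.ext (smul_monomial _ _ _).symm)

/-- The subspaces of an algebra, with the module structure of the algebra. -/
abbrev AlgebraSubspace (k A : Type*) [Field k] [CommRing A] [Algebra k A] : Type _ :=
  Submodule k A

/-- The grading of the special fiber of an ideal generated by forms of degree `d`. -/
noncomputable def fiberGrading (n : ℕ) : AlgebraSubspace k (SpecialFiber 𝒜 I) where
  carrier := Set.range (fiberClass 𝒜 I d n)
  add_mem' := by
    rintro _ _ ⟨a, rfl⟩ ⟨b, rfl⟩
    exact ⟨a + b, map_add _ _ _⟩
  zero_mem' := ⟨0, map_zero _⟩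
  smul_mem' := by
    rintro c _ ⟨a, rfl⟩
    exact ⟨c • a, map_smul _ _ _⟩

theorem fiberClass_mem_fiberGrading {n : ℕ} (a : degreePart 𝒜 (I ^ n) (n * d)) :
    fiberClass 𝒜 I d n a ∈ fiberGrading 𝒜 I d n :=
  ⟨a, rfl⟩

variable {𝒜 I d}

theorem mul_mem_degreePart {m n : ℕ} {a b : R} (ha : a ∈ degreePart 𝒜 (I ^ m) (m * d))
    (hb : b ∈ degreePart 𝒜 (I ^ n) (n * d)) :
    a * b ∈ degreePart 𝒜 (I ^ (m + n)) ((m + n) * d) := by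
  refine ⟨?_, ?_⟩
  · rw [pow_add]
    exact Ideal.mul_mem_mul ha.1 hb.1
  · rw [add_mul]
    exact SetLike.mul_mem_graded ha.2 hb.2

theorem fiberClass_mul {m n : ℕ} (a : degreePart 𝒜 (I ^ m) (m * d))
    (b : degreePart 𝒜 (I ^ n) (n * d)) : fiberClass 𝒜 I d m a * fiberClass 𝒜 I d n b =
      fiberClass 𝒜 I d (m + n) ⟨a.1 * b.1, mul_mem_degreePart a.2 b.2⟩ := by
  change Ideal.Quotient.mk _ _ * Ideal.Quotient.mk _ _ = Ideal.Quotient.mk _ _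
  rw [← map_mul, reesMonomial_mul]

theorem proj_coeff_eq_of_mk_eq (hI : IsEquigenerated 𝒜 I d) {p : reesAlgebra I}
    (h : (Ideal.Quotient.mk _ p : SpecialFiber 𝒜 I) = 0) (n : ℕ) :
    GradedAlgebra.proj 𝒜 (n * d) ((p : R[X]).coeff n) = 0 := by
  rw [Ideal.Quotient.eq_zero_iff_mem] at h
  exact (hI.pow n).proj_eq_zero_of_mem_irrelevant_mul (coeff_mem_of_mem_map h n)

theorem fiberClass_injective (hI : IsEquigenerated 𝒜 I d) (n : ℕ) :
    Function.Injective (fiberClass 𝒜 I d n) := by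
  rw [injective_iff_map_eq_zero]
  intro a ha
  have := proj_coeff_eq_of_mk_eq hI ha n
  rw [coe_reesMonomial, coeff_monomial_same, proj_apply_of_mem 𝒜 a.2.2] at this
  exact Subtype.ext this

theorem proj_mem_degreePart (hI : IsEquigenerated 𝒜 I d) {n : ℕ} {a : R} (ha : a ∈ I ^ n) :
    GradedAlgebra.proj 𝒜 (n * d) a ∈ degreePart 𝒜 (I ^ n) (n * d) :=
  ⟨(hI.pow n).proj_mem ha, proj_mem 𝒜 _ a⟩

theorem mk_reesMonomial (hI : IsEquigenerated 𝒜 I d) {n : ℕ} {a : R} (ha : a ∈ I ^ n) :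
    (Ideal.Quotient.mk _ (reesMonomial n a ha) : SpecialFiber 𝒜 I) =
      fiberClass 𝒜 I d n ⟨_, proj_mem_degreePart hI ha⟩ := by
  change _ = Ideal.Quotient.mk _ _
  rw [Ideal.Quotient.eq]
  have h1 := (hI.pow n).sub_proj_mem ha
  have := reesMonomial_mem_map h1 (Ideal.mul_le_right h1)
  convert this using 1
  exact Subtype.ext (map_sub _ _ _).symm

theorem isInternal_fiberGrading (hI : IsEquigenerated 𝒜 I d) :
    DirectSum.IsInternal (fiberGrading 𝒜 I d) := by
  refine isInternal_of_forall_sum (fun S v hv hsum n hn => ?_) fun x => ?_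
  · choose a ha using hv
    have hsum' : (Ideal.Quotient.mk _ (∑ i ∈ S,
        reesMonomial i (a i).1 ((mem_degreePart 𝒜).1 (a i).2).1) : SpecialFiber 𝒜 I) = 0 := by
      rw [map_sum, ← hsum]
      exact Finset.sum_congr rfl fun i _ => ha i
    have := proj_coeff_eq_of_mk_eq hI hsum' n
    rw [AddSubmonoidClass.coe_finsetSum, finsetSum_coeff, Finset.sum_eq_single n, coe_reesMonomial,
      coeff_monomial_same, proj_apply_of_mem 𝒜 (a n).2.2] at this
    · have h0 : a n = 0 := Subtype.ext this
      rw [← ha n, h0, map_zero]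
    · intro i _ hi
      exact coeff_monomial_of_ne _ (Ne.symm hi)
    · exact fun h => absurd hn h
  · obtain ⟨p, rfl⟩ := Ideal.Quotient.mk_surjective x
    refine ⟨(p : R[X]).support, fun n => fiberClass 𝒜 I d n ⟨_, proj_mem_degreePart hI (p.2 n)⟩,
      fun n => fiberClass_mem_fiberGrading _ _ _ _, ?_⟩
    conv_lhs => rw [eq_sum_reesMonomial p, map_sum]
    exact Finset.sum_congr rfl fun n _ => mk_reesMonomial hI _

/-- The graded algebra structure of the special fiber. -/
noncomputable abbrev fiberGradedAlgebra (hI : IsEquigenerated 𝒜 I d) :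
    GradedAlgebra (fiberGrading 𝒜 I d) :=
  { (isInternal_fiberGrading hI).chooseDecomposition with
    one_mem := ⟨⟨1, by simp, by simpa using SetLike.one_mem_graded 𝒜⟩, rfl⟩
    mul_mem := by
      rintro m n _ _ ⟨a, rfl⟩ ⟨b, rfl⟩
      exact ⟨_, (fiberClass_mul a b).symm⟩ }

theorem fiberGrading_zero (h0 : 𝒜 0 = 1) (hI : IsEquigenerated 𝒜 I d) :
    fiberGrading 𝒜 I d 0 = 1 := by
  let _ := fiberGradedAlgebra hI
  refine le_antisymm ?_ (Submodule.one_le.2 (SetLike.one_mem_graded (fiberGrading 𝒜 I d)))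
  rintro _ ⟨⟨a, ha⟩, rfl⟩
  have ha0 := ((mem_degreePart 𝒜).1 ha).2
  rw [zero_mul, h0, Submodule.mem_one] at ha0
  obtain ⟨c, rfl⟩ := ha0
  exact Submodule.mem_one.2 ⟨c, rfl⟩

theorem exists_finset_fiberGrading (hR : IsStandardGraded 𝒜) (n : ℕ) :
    ∃ S : Finset (SpecialFiber 𝒜 I), ∀ a ∈ fiberGrading 𝒜 I d n, ∃ c : SpecialFiber 𝒜 I → k,
      a = ∑ x ∈ S, algebraMap k (SpecialFiber 𝒜 I) (c x) * x := by
  have h1 : (degreePart 𝒜 (I ^ n) (n * d)).FG := (hR.fg (n * d)).of_le inf_le_right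
  have : Module.Finite k (degreePart 𝒜 (I ^ n) (n * d)) := Module.Finite.iff_fg.2 h1
  obtain ⟨S, hS⟩ := Module.Finite.iff_fg.1 (Module.Finite.range (fiberClass 𝒜 I d n))
  refine ⟨S, ?_⟩
  rintro _ ⟨a, rfl⟩
  have ha := LinearMap.mem_range_self (fiberClass 𝒜 I d n) a
  rw [← hS, Submodule.mem_span_finset] at ha
  obtain ⟨c, -, hc⟩ := ha
  refine ⟨c, hc.symm.trans (Finset.sum_congr rfl fun x _ => ?_)⟩
  obtain ⟨p, rfl⟩ := Ideal.Quotient.mk_surjective x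
  exact congrArg (Ideal.Quotient.mk _) (Algebra.smul_def _ p)

end SpecialFiber

/-! ### Tightness as a cancellation property, and generation in degree zero -/

section Tight

variable {k R : Type*} [Field k] [CommRing R] [Algebra k R] {𝒜 : ℕ → Submodule k R} {I : Ideal R}
  {d : ℕ}

theorem mem_degreePart_one {a : R} (ha : a ∈ I) (ha' : a ∈ 𝒜 d) :
    a ∈ degreePart 𝒜 (I ^ 1) (1 * d) := by
  rw [pow_one, one_mul]
  exact ⟨ha, ha'⟩

theorem isAnalyticallyTightInPower_iff {f : ℕ → R} {g : ℕ} {n : ℕ} (F : Fin (g + 1) → R)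
    (hF : ∀ i : Fin (g + 1), F i = f i) :
    IsAnalyticallyTightInPower 𝒜 I d F n ↔ ∀ a ∈ degreePart 𝒜 (I ^ n) (n * d),
      f g * a ∈ Ideal.span (f '' Set.Iio g) → a ∈ Ideal.span (f '' Set.Iio g) := by
  have hspan : (Set.range fun i : Fin g => F i.castSucc) = f '' Set.Iio g := by
    ext x
    constructor
    · rintro ⟨i, rfl⟩
      exact ⟨i, i.2, (hF i.castSucc).symm⟩
    · rintro ⟨i, hi, rfl⟩
      exact ⟨⟨i, hi⟩, hF _⟩
  have hlast : F (Fin.last g) = f g := hF _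
  rw [IsAnalyticallyTightInPower, hspan, hlast, SetLike.ext_iff]
  simp only [mem_degreePart, Ideal.mem_inf, Submodule.mem_colon_singleton, smul_eq_mul]
  constructor
  · intro h a ha hfa
    exact ((h a).1 ⟨⟨by rwa [mul_comm], ha.1⟩, ha.2⟩).1.1
  · intro h a
    refine ⟨fun ha => ⟨⟨h a ⟨ha.1.2, ha.2⟩ (by rw [mul_comm]; exact ha.1.1), ha.1.2⟩, ha.2⟩,
      fun ha => ⟨⟨Ideal.mul_mem_right _ _ ha.1.1, ha.1.2⟩, ha.2⟩⟩

theorem isAnalyticallyTight_bot {m : ℕ} (F : Fin (m + 1) → R) :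
    IsAnalyticallyTight 𝒜 ⊥ d F := by
  intro n hn
  have : (⊥ : Ideal R) ^ n = ⊥ := Ideal.bot_pow (by omega)
  rw [IsAnalyticallyTightInPower, this, inf_bot_eq, inf_bot_eq]

theorem IsEquigenerated.eq_bot_of_zero (h0 : 𝒜 0 = 1) (hI : IsEquigenerated 𝒜 I 0) (htop : I ≠ ⊤) :
    I = ⊥ := by
  obtain ⟨S, hS, rfl⟩ := hI
  refine Ideal.span_eq_bot.2 fun x hx => ?_
  by_contra hne
  have hx0 := hS hx
  rw [SetLike.mem_coe, h0, Submodule.mem_one] at hx0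
  obtain ⟨c, rfl⟩ := hx0
  have hc : c ≠ 0 := by
    rintro rfl
    exact hne (map_zero _)
  exact htop (Ideal.eq_top_of_isUnit_mem _ (Ideal.subset_span hx)
    ((isUnit_iff_ne_zero.2 hc).map (algebraMap k R)))

end Tight

/-! ### Transfer between R and the special fiber -/

section Main

variable {k R : Type*} [Field k] [CommRing R] [Algebra k R] {𝒜 : ℕ → Submodule k R}
  [GradedAlgebra 𝒜] {I : Ideal R} {d : ℕ}

/-- The linear forms of the special fiber given by a sequence of forms of degree `d` in `I`. -/
noncomputable def fiberForms {f : ℕ → R} (hf : ∀ i, f i ∈ I) (hfd : ∀ i, f i ∈ 𝒜 d) (i : ℕ) :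
    SpecialFiber 𝒜 I :=
  fiberClass 𝒜 I d 1 ⟨f i, mem_degreePart_one (hf i) (hfd i)⟩

variable {f : ℕ → R}

theorem mul_mem_degreePart_succ (hf : ∀ i, f i ∈ I) (hfd : ∀ i, f i ∈ 𝒜 d)
    {n : ℕ} (i : ℕ) {a : R} (ha : a ∈ degreePart 𝒜 (I ^ n) (n * d)) :
    f i * a ∈ degreePart 𝒜 (I ^ (n + 1)) ((n + 1) * d) := by
  rw [add_comm n 1]
  exact mul_mem_degreePart (mem_degreePart_one (hf i) (hfd i)) ha

theorem fiberClass_congr {m n : ℕ} (h : m = n) (a : degreePart 𝒜 (I ^ m) (m * d)) :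
    fiberClass 𝒜 I d m a = fiberClass 𝒜 I d n ⟨a.1, h ▸ a.2⟩ := by
  subst h
  rfl

theorem fiberForms_mul (hf : ∀ i, f i ∈ I) (hfd : ∀ i, f i ∈ 𝒜 d)
    {n : ℕ} (i : ℕ) (a : degreePart 𝒜 (I ^ n) (n * d)) :
    fiberForms hf hfd i * fiberClass 𝒜 I d n a =
      fiberClass 𝒜 I d (n + 1) ⟨f i * a.1, mul_mem_degreePart_succ hf hfd i a.2⟩ := by
  rw [fiberForms, fiberClass_mul, fiberClass_congr (add_comm 1 n)]

theorem exists_eq_sum_of_fiberClass_mem (hf : ∀ i, f i ∈ I) (hfd : ∀ i, f i ∈ 𝒜 d)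
    (hI : IsEquigenerated 𝒜 I d) {n s : ℕ} {a : R}
    (ha : a ∈ degreePart 𝒜 (I ^ (n + 1)) ((n + 1) * d))
    (h : fiberClass 𝒜 I d (n + 1) ⟨a, ha⟩ ∈ Ideal.span (fiberForms hf hfd '' Set.Iio s)) :
    ∃ b : ℕ → R, (∀ i < s, b i ∈ I ^ n) ∧ a = ∑ i ∈ Finset.range s, f i * b i := by
  let _ := fiberGradedAlgebra hI
  obtain ⟨c, hc, hac⟩ := exists_mem_sub_one (fiberGrading 𝒜 I d) (u := fiberForms hf hfd)
    (fun i _ => fiberClass_mem_fiberGrading _ _ _ _) (Nat.succ_pos n) (fiberClass_mem_fiberGrading _ _ _ _) h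
  have hc' : ∀ i, ∃ b : degreePart 𝒜 (I ^ n) (n * d), i < s → fiberClass 𝒜 I d n b = c i := by
    intro i
    by_cases hi : i < s
    · obtain ⟨b, hb⟩ := hc i hi
      exact ⟨b, fun _ => hb⟩
    · exact ⟨0, fun h => absurd h hi⟩
  choose b hb using hc'
  refine ⟨fun i => (b i).1, fun i _ => ((mem_degreePart 𝒜).1 (b i).2).1, ?_⟩
  have h1 : fiberClass 𝒜 I d (n + 1) ⟨a, ha⟩ = fiberClass 𝒜 I d (n + 1)
      (∑ i ∈ Finset.range s, ⟨f i * (b i).1, mul_mem_degreePart_succ hf hfd i (b i).2⟩) := by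
    rw [hac, map_sum]
    refine Finset.sum_congr rfl fun i hi => ?_
    rw [← hb i (Finset.mem_range.1 hi), fiberForms_mul]
  have h2 := congrArg Subtype.val (fiberClass_injective hI _ h1)
  rw [AddSubmonoidClass.coe_finsetSum] at h2
  exact h2

/-- The degree count: taking components in degree nd kills the error term in Iⁿ⁺¹, since d > 0, and
leaves an exact relation with coefficients in [Iⁿ⁻¹]_{(n-1)d}. -/
theorem fiberClass_mem_span (hf : ∀ i, f i ∈ I) (hfd : ∀ i, f i ∈ 𝒜 d)
    (hI : IsEquigenerated 𝒜 I d) (hd : 0 < d) {n s : ℕ} {a : R}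
    (ha : a ∈ degreePart 𝒜 (I ^ n) (n * d)) {c : ℕ → R} (hc : ∀ i < s, c i ∈ I ^ (n - 1))
    (hac : a - ∑ i ∈ Finset.range s, f i * c i ∈ I ^ (n + 1)) :
    fiberClass 𝒜 I d n ⟨a, ha⟩ ∈ Ideal.span (fiberForms hf hfd '' Set.Iio s) := by
  have hproj : a = ∑ i ∈ Finset.range s, GradedAlgebra.proj 𝒜 (n * d) (f i * c i) := by
    have h0 := (hI.pow (n + 1)).proj_eq_zero hac (m := n * d) (by rw [Nat.succ_mul]; omega)
    rwa [map_sub, proj_apply_of_mem 𝒜 ((mem_degreePart 𝒜).1 ha).2, map_sum, sub_eq_zero] at h0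
  cases n with
  | zero =>
    have ha0 : a = 0 := by
      rw [hproj]
      exact Finset.sum_eq_zero fun i _ => proj_mul_of_lt 𝒜 (hfd i) (by omega) _
    have : (⟨a, ha⟩ : degreePart 𝒜 (I ^ 0) (0 * d)) = 0 := Subtype.ext ha0
    rw [this, map_zero]
    exact zero_mem _
  | succ n =>
    have hc' : ∀ i, ∃ b : degreePart 𝒜 (I ^ n) (n * d),
        i < s → (b : R) = GradedAlgebra.proj 𝒜 (n * d) (c i) := by
      intro i
      by_cases hi : i < s
      · exact ⟨⟨_, proj_mem_degreePart hI (hc i hi)⟩, fun _ => rfl⟩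
      · exact ⟨0, fun h => absurd h hi⟩
    choose b hb using hc'
    have h1 : (⟨a, ha⟩ : degreePart 𝒜 (I ^ (n + 1)) ((n + 1) * d)) =
        ∑ i ∈ Finset.range s, ⟨f i * (b i).1, mul_mem_degreePart_succ hf hfd i (b i).2⟩ := by
      refine Subtype.ext ?_
      rw [AddSubmonoidClass.coe_finsetSum]
      refine hproj.trans (Finset.sum_congr rfl fun i hi => ?_)
      change _ = f i * (b i : R)
      rw [proj_mul_of_le 𝒜 (hfd i) (by rw [Nat.succ_mul]; omega), hb i (Finset.mem_range.1 hi),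
        Nat.succ_mul, Nat.add_sub_cancel]
    rw [h1, map_sum]
    rw [Finset.sum_congr rfl fun i _ => (fiberForms_mul hf hfd i (b i)).symm]
    exact sum_mul_mem_span (u := fiberForms hf hfd) fun i => fiberClass 𝒜 I d n (b i)

/-- A relation in the fiber lifts to R because `fiberClass` is injective. Conversely,
Valabrega–Valla improves the coefficients modulo Iⁿ⁺¹, and the degree count removes the error. -/
theorem fiberClass_mem_span_iff (hf : ∀ i, f i ∈ I) (hfd : ∀ i, f i ∈ 𝒜 d)
    (hI : IsEquigenerated 𝒜 I d) (hd : 0 < d) {g : ℕ}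
    (hreg : RegSeq (fun i => grImage I ⟨f i, hf i⟩) g) {n s : ℕ} (hs : s ≤ g) (hn : 1 ≤ n) {a : R}
    (ha : a ∈ degreePart 𝒜 (I ^ n) (n * d)) :
    fiberClass 𝒜 I d n ⟨a, ha⟩ ∈ Ideal.span (fiberForms hf hfd '' Set.Iio s) ↔
      a ∈ Ideal.span (f '' Set.Iio s) := by
  constructor
  · intro h
    obtain ⟨n, rfl⟩ := Nat.exists_eq_succ_of_ne_zero (Nat.one_le_iff_ne_zero.1 hn)
    obtain ⟨b, -, rfl⟩ := exists_eq_sum_of_fiberClass_mem hf hfd hI ha h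
    exact sum_mul_mem_span b
  · intro h
    obtain ⟨c, hc, hac⟩ := exists_of_mem_span_of_mem_pow hf hreg hs ((mem_degreePart 𝒜).1 ha).1 h
    exact fiberClass_mem_span hf hfd hI hd ha hc hac

theorem regSeq_fiberForms (hf : ∀ i, f i ∈ I) (hfd : ∀ i, f i ∈ 𝒜 d)
    (hI : IsEquigenerated 𝒜 I d) (hd : 0 < d) {g : ℕ}
    (hreg : RegSeq (fun i => grImage I ⟨f i, hf i⟩) g) : RegSeq (fiberForms hf hfd) g := by
  let _ := fiberGradedAlgebra hI
  have hu : ∀ i, fiberForms hf hfd i ∈ fiberGrading 𝒜 I d 1 :=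
    fun i => fiberClass_mem_fiberGrading _ _ _ _
  refine regSeq_of_forall_homogeneous (fiberGrading 𝒜 I d) (fun i _ => hu i) ?_
  rintro s hs n _ ⟨⟨a, ha⟩, rfl⟩ h1
  rw [fiberForms_mul] at h1
  obtain ⟨b, hb, hab⟩ := exists_eq_sum_of_fiberClass_mem hf hfd hI _ h1
  obtain ⟨c, hc, hac⟩ := exists_of_regSeq_grImage hf hreg hs ((mem_degreePart 𝒜).1 ha).1
    ⟨b, hb, by
      have : f s * a = ∑ i ∈ Finset.range s, f i * b i := hab
      rw [this, sub_self]
      exact zero_mem _⟩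
  exact fiberClass_mem_span hf hfd hI hd ha hc hac

theorem isAnalyticallyTight_iff_isCohenMacaulayRing (hf : ∀ i, f i ∈ I) (hfd : ∀ i, f i ∈ 𝒜 d)
    (hR : IsStandardGraded 𝒜)
    (hI : IsEquigenerated 𝒜 I d) (hd : 0 < d) (g : ℕ) (hdim : analyticSpread 𝒜 I = g + 1)
    (hreg : RegSeq (fun i => grImage I ⟨f i, hf i⟩) g)
    (hred : IsReduction (Ideal.span (f '' Set.Iio (g + 1))) I) (F : Fin (g + 1) → R)
    (hF : ∀ i : Fin (g + 1), F i = f i) :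
    IsAnalyticallyTight 𝒜 I d F ↔ IsCohenMacaulayRing (SpecialFiber 𝒜 I) := by
  let _ := fiberGradedAlgebra hI
  have hu : ∀ i, fiberForms hf hfd i ∈ fiberGrading 𝒜 I d 1 :=
    fun i => fiberClass_mem_fiberGrading _ _ _ _
  have : Algebra.FiniteType k R := hR.finiteType
  have : IsNoetherianRing R := Algebra.FiniteType.isNoetherianRing k R
  have : Algebra.FiniteType k (reesAlgebra I) := Algebra.FiniteType.trans (S := R) ‹_› inferInstance
  have : Algebra.FiniteType k (SpecialFiber 𝒜 I) :=
    Algebra.FiniteType.of_surjective (Ideal.Quotient.mkₐ k _) Ideal.Quotient.mk_surjective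
  have : Nontrivial (SpecialFiber 𝒜 I) := by
    by_contra h
    rw [not_nontrivial_iff_subsingleton] at h
    rw [analyticSpread, ringKrullDim_eq_bot_of_subsingleton] at hdim
    exact absurd hdim.symm (by norm_cast)
  obtain ⟨-, N, hN⟩ := hred
  have hN' : ∀ n ≥ N + 1, ∀ x ∈ fiberGrading 𝒜 I d n,
      x ∈ Ideal.span (fiberForms hf hfd '' Set.Iio (g + 1)) := by
    rintro n hn _ ⟨⟨a, ha⟩, rfl⟩
    have ha' := ((mem_degreePart 𝒜).1 ha).1
    -- The reduction equation at exponent `N`, multiplied by a power of I, holds for all larger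
    -- exponents; hence the threshold `N + 1`.
    have hpow : I ^ n = Ideal.span (f '' Set.Iio (g + 1)) * I ^ (n - 1) := by
      obtain ⟨m, rfl⟩ := Nat.exists_eq_add_of_le hn
      rw [show N + 1 + m - 1 = N + m by omega, pow_add I N m, ← mul_assoc, hN, pow_add I (N + 1)]
    rw [hpow] at ha'
    obtain ⟨c, hc, hac⟩ := exists_of_mem_span_mul ha'
    exact fiberClass_mem_span hf hfd hI hd ha (fun i _ => hc i)
      (by rw [← hac, sub_self]; exact zero_mem _)
  rw [← isCohenMacaulayRing_iff_of_regSeq (fiberGrading 𝒜 I d)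
    (fiberGrading_zero hR.degree_zero hI) (exists_finset_fiberGrading hR) (fun i _ => hu i)
    (regSeq_fiberForms hf hfd hI hd hreg) hN' hdim]
  refine forall₂_congr fun n hn => ?_
  rw [isAnalyticallyTightInPower_iff F hF]
  constructor
  · rintro h _ ⟨⟨a, ha⟩, rfl⟩ hfa
    rw [fiberForms_mul, fiberClass_mem_span_iff hf hfd hI hd hreg le_rfl (by omega)] at hfa
    rw [fiberClass_mem_span_iff hf hfd hI hd hreg le_rfl hn]
    exact h a ha hfa
  · intro h a ha hfa
    rw [← fiberClass_mem_span_iff hf hfd hI hd hreg le_rfl hn ha]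
    refine h _ (fiberClass_mem_fiberGrading _ _ _ _) ?_
    rwa [fiberForms_mul, fiberClass_mem_span_iff hf hfd hI hd hreg le_rfl (by omega)]

end Main

end FiberCone

theorem mainTheorem1 {k R : Type*} [Field k] [Infinite k] [CommRing R] [Algebra k R]
    (𝒜 : ℕ → Submodule k R) [GradedAlgebra 𝒜] (hR : FiberCone.IsStandardGraded 𝒜)
    (I : Ideal R) (d : ℕ) (hI : FiberCone.IsEquigenerated 𝒜 I d)
    (g : ℕ) (hg : I.height = (g : ℕ∞))
    (hdev : FiberCone.analyticSpread 𝒜 I = ((I.height : ℕ∞) : WithBot ℕ∞) + 1)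
    (f : Fin (g + 1) → R) (hfI : ∀ i, f i ∈ I) (hfd : ∀ i, f i ∈ 𝒜 d)
    (hreg : RingTheory.Sequence.IsRegular (FiberCone.AssociatedGradedRing I)
      (List.ofFn fun i : Fin g => FiberCone.grImage I ⟨f i.castSucc, hfI i.castSucc⟩))
    (hred : FiberCone.IsReduction (Ideal.span (Set.range f)) I) :
    FiberCone.IsAnalyticallyTight 𝒜 I d f ↔
      FiberCone.IsCohenMacaulayRing (FiberCone.SpecialFiber 𝒜 I) := by
  -- The default 0 lies in `I` and in every `𝒜 d`, so the extended sequence meets the same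
  -- conditions at all indices.
  let F : ℕ → R := fun i => if h : i < g + 1 then f ⟨i, h⟩ else 0
  have hFf : ∀ i : Fin (g + 1), f i = F i := fun i => (show F i = f i from dif_pos i.2).symm
  have hF : ∀ i, F i ∈ I := fun i => by
    by_cases h : i < g + 1
    · simpa only [F, dif_pos h] using hfI _
    · simp only [F, dif_neg h, zero_mem]
  have hdim : FiberCone.analyticSpread 𝒜 I = g + 1 := by
    rw [hdev, hg]
    rfl
  have hreg' : FiberCone.RegSeq (fun i => FiberCone.grImage I ⟨F i, hF i⟩) g := by
    rw [← FiberCone.isWeaklyRegular_map_range_iff]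
    have hlist : (List.range g).map (fun i => FiberCone.grImage I ⟨F i, hF i⟩) =
        List.ofFn fun i : Fin g => FiberCone.grImage I ⟨f i.castSucc, hfI i.castSucc⟩ := by
      refine List.ext_getElem (by rw [List.length_map, List.length_range, List.length_ofFn])
        fun i h1 h2 => ?_
      rw [List.getElem_map, List.getElem_range, List.getElem_ofFn]
      exact congrArg _ (Subtype.ext (hFf (Fin.castSucc ⟨i, _⟩)).symm)
    rw [hlist]
    exact hreg.toIsWeaklyRegular
  have hrange : Set.range f = F '' Set.Iio (g + 1) := by
    ext x
    constructor
    · rintro ⟨i, rfl⟩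
      exact ⟨i, i.2, (hFf i).symm⟩
    · rintro ⟨i, hi, rfl⟩
      exact ⟨⟨i, hi⟩, hFf _⟩
  rw [hrange] at hred
  have htop : I ≠ ⊤ := by
    rintro rfl
    rw [Ideal.height_top] at hg
    exact ENat.top_ne_natCast g hg
  rcases Nat.eq_zero_or_pos d with rfl | hd
  · obtain rfl := hI.eq_bot_of_zero hR.degree_zero htop
    -- The zero ideal is also generated in degree 1, so the case d > 0 applies with d = 1. Tightness
    -- for the zero ideal holds in either degree.
    have hF0 : ∀ i, F i ∈ 𝒜 1 := fun i => (Ideal.mem_bot.1 (hF i)).symm ▸ zero_mem _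
    rw [← FiberCone.isAnalyticallyTight_iff_isCohenMacaulayRing hF hF0 hR
      ⟨∅, Set.empty_subset _, Ideal.span_empty.symm⟩ Nat.one_pos g hdim hreg' hred f hFf]
    exact iff_of_true (FiberCone.isAnalyticallyTight_bot f) (FiberCone.isAnalyticallyTight_bot f)
  · have hFd : ∀ i, F i ∈ 𝒜 d := fun i => by
      by_cases h : i < g + 1
      · simpa only [F, dif_pos h] using hfd _
      · simp only [F, dif_neg h, zero_mem]
    exact FiberCone.isAnalyticallyTight_iff_isCohenMacaulayRing hF hFd hR hI hd g hdim hreg' hred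
      f hFf
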